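/- Let $A$ be a finite-dimensional algebra over a field $k$ which is symmetric, i.e. $A\cong\operatorname{Hom}_k(A,k)$ as $A$-bimodules. Modules are right modules. $\mathsf K(A)$ is the homotopy category of cochain complexes of $A$-modules, $\mathsf K^{b}(\mathrm{proj}A)\subseteq\mathsf K(A)$ the full subcategory of objects isomorphic to bounded complexes of finitely generated projective modules, and Hom denotes morphisms in $\mathsf K(A)$. A complex $P\in\mathsf K^{b}(\mathrm{proj}A)$ is partial tilting if $\operatorname{Hom}(P,P[i])=0$ for all $i\neq0$; it is tilting if moreover the smallest triangulated subcategory of $\mathsf K(A)$ that contains $P$ and is closed under direct summands contains $\mathsf K^{b}(\mathrm{proj}A)$. By $\operatorname{add}P$ we denote the class of direct summands of finite direct sums of copies of $P$. Let $P\in\mathsf K^{b}(\mathrm{proj}A)$ be a partial tilting complex of length $r+1$, that is, for some integers $s$ and $r\ge0$ the largest $i$ with $H^i(P)\ne0$ is $s$ and the smallest one is $s-r$. Construct a sequence $\Delta_n=\Delta_n(P,A)$, $n\ge0$, as follows: $\Delta_0=A$ (in degree $0$), and for $n\ge1$ choose $P_n\in\operatorname{add}P$ and a morphism $g'_n:P_n\to\Delta_{n-1}[r-s-n+1]$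 such that $\operatorname{Hom}(P,g'_n):\operatorname{Hom}(P,P_n)\to\operatorname{Hom}(P,\Delta_{n-1}[r-s-n+1])$ is a projective cover of right $\operatorname{End}(P)$-modules (so $P_n=0$ if the target is $0$), and let $\Delta_n$ be a cone of $g'_n[n+s-r-1]$, so that there is a distinguished triangle $$P_n[n+s-r-1]\xrightarrow{\,g'_n[n+s-r-1]\,}\Delta_{n-1}\to\Delta_n\to P_n[n+s-r].$$ Put $\Theta_n(P,A)=\Delta_n(P,A)\oplus P[n+s-r]$. Theorem. Such a sequence exists, and for every such sequence the following are equivalent: (1) $H^i(\Delta_r(P,A))=0$ for all $i>0$; (2) $\Theta_n(P,A)$ is a tilting complex for every $n\ge r$. -/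

import Mathlib

open CategoryTheory CategoryTheory.Limits CategoryTheory.Pretriangulated

universe v u w

/-- A surjection `f : Q → M` of `R`-modules with `Q` projective and with superfluous kernel. -/
structure IsProjectiveCover {R : Type*} {Q M : Type*} [Ring R] [AddCommGroup Q] [Module R Q]
    [AddCommGroup M] [Module R M] (f : Q →ₗ[R] M) : Prop where
  projective : Module.Projective R Q
  surjective : Function.Surjective f
  superfluous : ∀ N : Submodule R Q, N ⊔ LinearMap.ker f = ⊤ → N = ⊤

section Triangulated

variable {C : Type u} [Category.{v} C] [Preadditive C] [HasZeroObject C]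

/-- `X` belongs to `add P`: it is a direct summand of a finite direct sum of copies of `P`. -/
def InAdd [HasFiniteBiproducts C] (P X : C) : Prop :=
  ∃ n : ℕ, Nonempty (Retract X (⨁ fun _ : Fin n => P))

variable [HasShift C ℤ] [∀ n : ℤ, (shiftFunctor C n).Additive] [Pretriangulated C]

/-- One step of the construction of the complexes `Δ`: there are `Q` in `add P` and
`g' : Q ⟶ X[-m]` such that `Hom(P, g') : Hom(P, Q) ⟶ Hom(P, X[-m])` is a projective cover of
right `End(P)`-modules, and a distinguished triangle `Q[m] ⟶ X ⟶ Y ⟶ Q[m+1]` whose first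
morphism is `g'[m]`. If `Hom(P, X[-m]) = 0`, the condition on `g'` says precisely that `Q = 0`.
Recall that in Mathlib the product of `End P` is composition of maps, `f * g = g ≫ f`, and that
`preadditiveCoyonedaObj P` is the functor `Hom(P, -)` to right `End P`-modules. -/
def IsDeltaStep [HasFiniteBiproducts C] (P : C) (m : ℤ) (X Y : C) : Prop :=
  ∃ (Q : C) (g' : Q ⟶ X⟦-m⟧) (h : X ⟶ Y) (δ : Y ⟶ Q⟦m⟧⟦(1 : ℤ)⟧),
    InAdd P Q ∧
    IsProjectiveCover ((preadditiveCoyonedaObj P).map g').hom ∧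
    Triangle.mk (g'⟦m⟧' ≫ (shiftFunctorCompIsoId C (-m) m (neg_add_cancel m)).hom.app X) h δ
      ∈ distTriang C

/-- `Δ₀, Δ₁, Δ₂, …` is a family obtained from `M` by the iterated construction: `Δ₀` is `M`, and
for `n ≥ 1` the object `Δₙ` is a cone of `Pₙ[n+s-r-1] ⟶ Δₙ₋₁`. (The index is shifted by one
below.) -/
def IsDeltaFamily [HasFiniteBiproducts C] (P M : C) (s : ℤ) (r : ℕ) (Δ : ℕ → C) : Prop :=
  Nonempty (Δ 0 ≅ M) ∧ ∀ n : ℕ, IsDeltaStep P (n + s - r) (Δ n) (Δ (n + 1))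

/-- `Hom(X, X[n]) = 0` for all `n ≠ 0`. -/
def IsSelfOrthogonal (X : C) : Prop :=
  ∀ n : ℤ, n ≠ 0 → ∀ f : X ⟶ X⟦n⟧, f = 0

/-- `Θₙ = Δₙ ⊕ P[n+s-r]`. -/
noncomputable def thetaObj [HasBinaryBiproducts C] (P : C) (s : ℤ) (r : ℕ) (Δ : ℕ → C) (n : ℕ) :
    C :=
  Δ n ⊞ P⟦(n + s - r : ℤ)⟧

end Triangulated

section Algebras

/-- The finite-dimensional algebra `A` is symmetric: `A` and `DA = Hom_k(A, k)` are isomorphic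
as `A`-bimodules, where `(a f b)(y) = f (b y a)` for `f` in `DA`. -/
def IsSymmetricAlg (k : Type w) (A : Type u) [Field k] [Ring A] [Algebra k A] : Prop :=
  ∃ φ : A ≃ₗ[k] (A →ₗ[k] k), ∀ a x b y : A, φ (a * x * b) y = φ x (b * y * a)

variable (A : Type u) [Ring A]

/-- The homotopy category `K(A)` of cochain complexes of right `A`-modules. -/
abbrev KMod : Type _ := HomotopyCategory (ModuleCat.{u} Aᵐᵒᵖ) (ComplexShape.up ℤ)

instance : HasFiniteBiproducts (KMod A) := HasFiniteBiproducts.of_hasFiniteProducts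

/-- The right regular module `A`, as a complex concentrated in degree zero. -/
noncomputable def regularComplex : KMod A :=
  (HomotopyCategory.singleFunctor (ModuleCat.{u} Aᵐᵒᵖ) 0).obj (ModuleCat.of Aᵐᵒᵖ A)

/-- The objects of `K^b(proj A)`: those of `K(A)` isomorphic to a bounded complex of finitely
generated projective right `A`-modules. -/
def KbProj : ObjectProperty (KMod A) := fun X =>
  ∃ K : CochainComplex (ModuleCat.{u} Aᵐᵒᵖ) ℤ,
    (∃ a b : ℤ, ∀ i : ℤ, (i < a ∨ b < i) → IsZero (K.X i)) ∧
    (∀ i : ℤ, Module.Finite Aᵐᵒᵖ (K.X i) ∧ Module.Projective Aᵐᵒᵖ (K.X i)) ∧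
    Nonempty (X ≅ (HomotopyCategory.quotient _ _).obj K)

variable {A}

/-- The cohomology module `H^i(X)`. -/
noncomputable def cohomology (X : KMod A) (i : ℤ) : ModuleCat.{u} Aᵐᵒᵖ :=
  (HomotopyCategory.homologyFunctor (ModuleCat.{u} Aᵐᵒᵖ) (ComplexShape.up ℤ) i).obj X

/-- `X` has length `r + 1`, with top cohomology in degree `s`: the largest degree of a nonzero
cohomology module is `s` and the smallest one is `s - r`. -/
def HasLengthWithTop (X : KMod A) (s : ℤ) (r : ℕ) : Prop :=
  IsGreatest {i : ℤ | ¬ IsZero (cohomology X i)} s ∧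
    IsLeast {i : ℤ | ¬ IsZero (cohomology X i)} (s - r)

/-- Partial tilting complexes (in `K^b(proj A)`, a full subcategory of both `K(A)` and `D(A)`). -/
def IsPartialTilting (X : KMod A) : Prop :=
  KbProj A X ∧ IsSelfOrthogonal X

/-- Tilting complexes: partial tilting complexes `T` that generate `K^b(proj A)`, which means
that `K^b(proj A)` is contained in the smallest triangulated subcategory that contains `T` and is
closed under direct summands. -/
def IsTilting (T : KMod A) : Prop :=
  IsPartialTilting T ∧ KbProj A ≤ (ObjectProperty.singleton T).triangEnvelope

end Algebras

/-!
For `X` and `Y` in `K^b(proj A)`, a symmetrizing form of `A` makes the supertrace of `X ⟶ Y ⟶ X`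
a pairing which is perfect in each degree, so `Hom(X, Y) = 0` if and only if `Hom(Y, X) = 0`. Hence
`Hom(P, A[i])` vanishes if and only if `H⁻ⁱ(P)` does, that is, at least outside `[-s, r - s]`.

Since `Hom(P, g'ₙ)` is surjective and `P` is self-orthogonal, passing from `Δₙ₋₁` to `Δₙ` kills
`Hom(P, Δₙ₋₁[i])` in one degree, from the top downwards; for `n ≥ r` only the degree `r - s - n`
remains. By symmetry the same holds for `Hom(Δₙ, P[i])`, and so `Θₙ` is self-orthogonal as soon as
`Hom(Δₙ, Δₙ[i]) = 0` for `i > 0`. For `n = r`, the triangles that build `Δᵣ` from `A` identify this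
condition with `Hom(A, Δᵣ[i]) = Hⁱ(Δᵣ) = 0`, and the later triangles propagate it to all `n ≥ r`.
Finally, `Θₙ` generates `P`, hence `Δₙ`, hence `A` through the same triangles.
-/

section HomVanish

variable {C : Type u} [Category.{v} C] [Preadditive C] [HasShift C ℤ] {X X' Y Y' : C} {n : ℤ}

/-- The group of morphisms of degree `n` from `X` to `Y` vanishes: `Hom(X, Y[n]) = 0`. -/
def HomVanish (X Y : C) (n : ℤ) : Prop := ∀ f : X ⟶ Y⟦n⟧, f = 0

lemma homVanish_shift_left_iff (X Y : C) (a n : ℤ) :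
    HomVanish (X⟦a⟧) Y n ↔ HomVanish X Y (n - a) := by
  let e : Y⟦n⟧ ≅ Y⟦n - a⟧⟦a⟧ := (shiftFunctorAdd' C (n - a) a n (sub_add_cancel n a)).app Y
  constructor
  · intro h f
    apply (shiftFunctor C a).map_injective
    rw [← cancel_mono e.inv, h (f⟦a⟧' ≫ e.inv), Functor.map_zero, zero_comp]
  · intro h f
    obtain ⟨g, hg⟩ := (shiftFunctor C a).map_surjective (f ≫ e.hom)
    rw [← cancel_mono e.hom, ← hg, h g, Functor.map_zero, zero_comp]

lemma homVanish_shift_right_iff (X Y : C) (a n : ℤ) :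
    HomVanish X (Y⟦a⟧) n ↔ HomVanish X Y (a + n) := by
  let e : Y⟦a + n⟧ ≅ Y⟦a⟧⟦n⟧ := (shiftFunctorAdd C a n).app Y
  constructor
  · intro h f
    rw [← cancel_mono e.hom, h (f ≫ e.hom), zero_comp]
  · intro h f
    rw [← cancel_mono e.inv, h (f ≫ e.inv), zero_comp]

namespace HomVanish

lemma retract_left (h : HomVanish X Y n) (e : Retract X' X) : HomVanish X' Y n := fun f => by
  rw [← Category.id_comp f, ← e.retract, Category.assoc, h (e.r ≫ f), comp_zero]

lemma retract_right (h : HomVanish X Y n) (e : Retract Y' Y) : HomVanish X Y' n := fun f => by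
  have he : f = (f ≫ e.i⟦n⟧') ≫ e.r⟦n⟧' := by
    rw [Category.assoc, ← Functor.map_comp, e.retract, (shiftFunctor C n).map_id, Category.comp_id]
  rw [he, h (f ≫ _), zero_comp]

lemma biprod_left [HasBinaryBiproducts C] (h : HomVanish X Y n) (h' : HomVanish X' Y n) :
    HomVanish (X ⊞ X') Y n := fun f =>
  biprod.hom_ext' _ _ (by rw [h (_ ≫ f), comp_zero]) (by rw [h' (_ ≫ f), comp_zero])

lemma inAdd_left [HasFiniteBiproducts C] (h : HomVanish X Y n) (hX' : InAdd X X') :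
    HomVanish X' Y n := by
  obtain ⟨m, ⟨e⟩⟩ := hX'
  refine retract_left (fun f => ?_) e
  exact biproduct.hom_ext' _ _ fun j => by rw [h (_ ≫ f), comp_zero]

variable [∀ n : ℤ, (shiftFunctor C n).Additive]

lemma biprod_right [HasBinaryBiproducts C] (h : HomVanish X Y n) (h' : HomVanish X Y' n) :
    HomVanish X (Y ⊞ Y') n := fun f => by
  rw [← Category.comp_id f, ← (shiftFunctor C n).map_id, ← biprod.total, Functor.map_add,
    Functor.map_comp, Functor.map_comp, Preadditive.comp_add, ← Category.assoc, ← Category.assoc,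
    h (f ≫ _), h' (f ≫ _), zero_comp, zero_comp, add_zero]

lemma inAdd_right [HasFiniteBiproducts C] (h : HomVanish X Y n) (hY' : InAdd Y Y') :
    HomVanish X Y' n := by
  obtain ⟨m, ⟨e⟩⟩ := hY'
  refine retract_right (fun f => ?_) e
  rw [← Category.comp_id f, ← (shiftFunctor C n).map_id, ← biproduct.total, Functor.map_sum,
    Preadditive.comp_sum]
  refine Finset.sum_eq_zero fun j _ => ?_
  rw [Functor.map_comp, ← Category.assoc, h (f ≫ _), zero_comp]

variable [HasZeroObject C] [Pretriangulated C] {T : Triangle C}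

lemma triangle_left₂ (hT : T ∈ distTriang C) (h₁ : HomVanish T.obj₁ Y n)
    (h₃ : HomVanish T.obj₃ Y n) : HomVanish T.obj₂ Y n := fun f => by
  obtain ⟨g, rfl⟩ := Triangle.yoneda_exact₂ T hT f (h₁ _)
  rw [h₃ g, comp_zero]

lemma triangle_right₂ (hT : T ∈ distTriang C) (h₁ : HomVanish X T.obj₁ n)
    (h₃ : HomVanish X T.obj₃ n) : HomVanish X T.obj₂ n := fun f => by
  obtain ⟨g, rfl⟩ := Triangle.coyoneda_exact₂ _ (Triangle.shift_distinguished T hT n) f (h₃ _)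
  rw [h₁ g]
  exact zero_comp

end HomVanish

/-- Vanishing of morphisms between objects of `T` is symmetric up to the sign of the degree: the
shadow on vanishing statements of a `0`-Calabi–Yau duality `Hom(X, Y[n]) ≅ Hom(Y, X[-n])^*`. -/
def IsHomSymmetric (T : ObjectProperty C) : Prop :=
  ∀ ⦃X Y : C⦄, T X → T Y → ∀ n : ℤ, HomVanish X Y n → HomVanish Y X (-n)

end HomVanish

section DeltaStep

variable {C : Type u} [Category.{v} C] [Preadditive C] [HasZeroObject C] [HasFiniteBiproducts C]
  [HasShift C ℤ] [∀ n : ℤ, (shiftFunctor C n).Additive] [Pretriangulated C]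

lemma InAdd.prop {Q : ObjectProperty C} [Q.IsTriangulated] [Q.IsStableUnderRetracts] {P X : C}
    (hX : InAdd P X) (hP : Q P) : Q X := by
  obtain ⟨n, ⟨e⟩⟩ := hX
  exact Q.prop_of_retract e (Q.prop_of_isLimit_fan (biproduct.isLimit _) fun _ => hP)

namespace IsDeltaStep

variable {P X Y Z : C} {m i : ℤ}

lemma exists_triangle (h : IsDeltaStep P m X Y) :
    ∃ (Q : C) (f : Q⟦m⟧ ⟶ X) (g : X ⟶ Y) (δ : Y ⟶ Q⟦m⟧⟦(1 : ℤ)⟧),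
      InAdd P Q ∧ Triangle.mk f g δ ∈ distTriang C := by
  obtain ⟨Q, _, g, δ, hQ, _, hT⟩ := h
  exact ⟨Q, _, g, δ, hQ, hT⟩

lemma homVanish_left (h : IsDeltaStep P m X Y) (hP : HomVanish P Z (i - 1 - m))
    (hX : HomVanish X Z i) : HomVanish Y Z i := by
  obtain ⟨Q, f, g, δ, hQ, hT⟩ := h.exists_triangle
  refine HomVanish.triangle_left₂ (rot_of_distTriang _ hT) hX ?_
  exact (homVanish_shift_left_iff _ _ _ _).2
    ((homVanish_shift_left_iff _ _ _ _).2 (hP.inAdd_left hQ))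

lemma homVanish_source_left (h : IsDeltaStep P m X Y) (hP : HomVanish P Z (i - m))
    (hY : HomVanish Y Z i) : HomVanish X Z i := by
  obtain ⟨Q, f, g, δ, hQ, hT⟩ := h.exists_triangle
  refine HomVanish.triangle_left₂ hT ?_ hY
  exact (homVanish_shift_left_iff _ _ _ _).2 (hP.inAdd_left hQ)

lemma homVanish_right (h : IsDeltaStep P m X Y) (hP : HomVanish Z P (m + (1 + i)))
    (hX : HomVanish Z X i) : HomVanish Z Y i := by
  obtain ⟨Q, f, g, δ, hQ, hT⟩ := h.exists_triangle
  refine HomVanish.triangle_right₂ (rot_of_distTriang _ hT) hX ?_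
  exact (homVanish_shift_right_iff _ _ _ _).2
    ((homVanish_shift_right_iff _ _ _ _).2 (hP.inAdd_right hQ))

lemma homVanish_neg (h : IsDeltaStep P m X Y) (hP : HomVanish P P 1) : HomVanish P Y (-m) := by
  obtain ⟨Q, g', g, δ, hQ, hg', hT⟩ := h
  suffices H : ∀ f : P⟦m⟧ ⟶ Y, f = 0 by
    refine zero_sub m ▸ (homVanish_shift_left_iff P Y m 0).1 fun f => ?_
    rw [← cancel_mono ((shiftFunctorZero C ℤ).hom.app Y), H (f ≫ _), zero_comp]
  intro f
  have hQ' : HomVanish (P⟦m⟧) (Q⟦m⟧) 1 := by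
    rw [homVanish_shift_left_iff, homVanish_shift_right_iff, add_sub_cancel]
    exact hP.inAdd_right hQ
  obtain ⟨x, rfl⟩ : ∃ x : P⟦m⟧ ⟶ X, f = x ≫ g := Triangle.coyoneda_exact₃ _ hT f (hQ' _)
  let e := (shiftFunctorCompIsoId C (-m) m (neg_add_cancel m)).app X
  obtain ⟨y, hy⟩ := (shiftFunctor C m).map_surjective (x ≫ e.inv)
  obtain ⟨z, rfl⟩ : ∃ z : P ⟶ Q, z ≫ g' = y := hg'.surjective y
  have hx : x = z⟦m⟧' ≫ g'⟦m⟧' ≫ e.hom := by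
    rw [← Functor.map_comp_assoc, hy, Category.assoc, e.inv_hom_id]
    exact (Category.comp_id x).symm
  have hzero : (g'⟦m⟧' ≫ e.hom) ≫ g = 0 := comp_distTriang_mor_zero₁₂ _ hT
  rw [hx, Category.assoc, hzero, comp_zero]

variable {T : ObjectProperty C} [T.IsTriangulated] [T.IsStableUnderRetracts]

lemma prop_target (h : IsDeltaStep P m X Y) (hP : T P) (hX : T X) : T Y := by
  obtain ⟨Q, f, g, δ, hQ, hT⟩ := h.exists_triangle
  exact T.ext_of_isTriangulatedClosed₃ _ hT (T.le_shift _ _ (hQ.prop hP)) hX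

lemma prop_source (h : IsDeltaStep P m X Y) (hP : T P) (hY : T Y) : T X := by
  obtain ⟨Q, f, g, δ, hQ, hT⟩ := h.exists_triangle
  exact T.ext_of_isTriangulatedClosed₂ _ hT (T.le_shift _ _ (hQ.prop hP)) hY

end IsDeltaStep

end DeltaStep

section Theta

variable {C : Type u} [Category.{v} C] [Preadditive C] [HasZeroObject C] [HasShift C ℤ]
  [∀ n : ℤ, (shiftFunctor C n).Additive] [Pretriangulated C] {P : C} {s : ℤ} {r n : ℕ} {Δ : ℕ → C}

lemma prop_thetaObj {T : ObjectProperty C} [T.IsTriangulated] [T.IsClosedUnderIsomorphisms]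
    (hP : T P) (hΔ : T (Δ n)) : T (thetaObj P s r Δ n) :=
  T.prop_of_isLimit_binaryFan (BinaryBiproduct.isLimit _ _) hΔ (T.le_shift _ _ hP)

lemma isSelfOrthogonal_thetaObj_iff (hP : IsSelfOrthogonal P)
    (h : ∀ i ≠ r - s - n, HomVanish P (Δ n) i) (h' : ∀ i ≠ n + s - r, HomVanish (Δ n) P i) :
    IsSelfOrthogonal (thetaObj P s r Δ n) ↔ IsSelfOrthogonal (Δ n) := by
  constructor
  · intro H i hi
    let e : Retract (Δ n) (thetaObj P s r Δ n) := ⟨biprod.inl, biprod.fst, biprod.inl_fst⟩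
    exact (HomVanish.retract_left (H i hi) e).retract_right e
  · intro H i hi
    refine HomVanish.biprod_left (HomVanish.biprod_right (H i hi) ?_) (HomVanish.biprod_right ?_ ?_)
    · exact (homVanish_shift_right_iff _ _ _ _).2 (h' _ (by lia))
    · exact (homVanish_shift_left_iff _ _ _ _).2 (h _ (by lia))
    · exact (homVanish_shift_left_iff _ _ _ _).2
        ((homVanish_shift_right_iff _ _ _ _).2 (hP _ (by lia)))

end Theta

section DeltaFamily

variable {C : Type u} [Category.{v} C] [Preadditive C] [HasZeroObject C] [HasFiniteBiproducts C]
  [HasShift C ℤ] [∀ n : ℤ, (shiftFunctor C n).Additive] [Pretriangulated C]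
  {P M : C} {s : ℤ} {r n : ℕ} {Δ : ℕ → C}

namespace IsDeltaFamily

lemma homVanish_of_lt_or_lt (hΔ : IsDeltaFamily P M s r Δ) (hP : IsSelfOrthogonal P)
    (hM : ∀ i : ℤ, (i < -s ∨ r - s < i) → HomVanish P M i) (n : ℕ) (i : ℤ)
    (hi : (i < -s ∧ i < r - s - n) ∨ r - s - n < i) : HomVanish P (Δ n) i := by
  induction n generalizing i with
  | zero => exact (hM i (by grind)).retract_right (.ofIso hΔ.1.some)
  | succ n ih =>
    by_cases h : i = -(n + s - r)
    · exact h ▸ (hΔ.2 n).homVanish_neg (hP 1 one_ne_zero)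
    · push_cast at hi
      exact (hΔ.2 n).homVanish_right (hP _ (by lia)) (ih i (by lia))

lemma homVanish_of_ne (hΔ : IsDeltaFamily P M s r Δ) (hP : IsSelfOrthogonal P)
    (hM : ∀ i : ℤ, (i < -s ∨ r - s < i) → HomVanish P M i) (hn : r ≤ n) {i : ℤ}
    (hi : i ≠ r - s - n) : HomVanish P (Δ n) i :=
  hΔ.homVanish_of_lt_or_lt hP hM n i (by lia)

lemma homVanish_self_iff (hΔ : IsDeltaFamily P M s r Δ) (hP : IsSelfOrthogonal P)
    (hM : ∀ i : ℤ, (i < -s ∨ r - s < i) → HomVanish P M i) {i : ℤ} (hi : 0 < i) :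
    HomVanish (Δ r) (Δ r) i ↔ HomVanish M (Δ r) i := by
  have hPΔ {j : ℤ} (hj : j ≠ -s) : HomVanish P (Δ r) j :=
    hΔ.homVanish_of_ne hP hM le_rfl (by lia)
  suffices key : ∀ n ≤ r, HomVanish (Δ n) (Δ r) i ↔ HomVanish M (Δ r) i from key r le_rfl
  intro n
  induction n with
  | zero =>
    exact fun _ => ⟨fun h => h.retract_left (.ofIso hΔ.1.some.symm),
      fun h => h.retract_left (.ofIso hΔ.1.some)⟩
  | succ n ih =>
    intro hn
    rw [← ih (by lia)]
    exact ⟨(hΔ.2 n).homVanish_source_left (hPΔ (by lia)),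
      (hΔ.2 n).homVanish_left (hPΔ (by lia))⟩

lemma homVanish_self_of_le (hΔ : IsDeltaFamily P M s r Δ) (hP : IsSelfOrthogonal P)
    (hM : ∀ i : ℤ, (i < -s ∨ r - s < i) → HomVanish P M i)
    (hΔP : ∀ n : ℕ, r ≤ n → ∀ i ≠ n + s - r, HomVanish (Δ n) P i)
    (h : ∀ i : ℤ, 0 < i → HomVanish (Δ r) (Δ r) i) (hn : r ≤ n) (i : ℤ) (hi : 0 < i) :
    HomVanish (Δ n) (Δ n) i := by
  induction n, hn using Nat.le_induction with
  | base => exact h i hi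
  | succ n hn ih =>
    refine (hΔ.2 n).homVanish_left ?_ ((hΔ.2 n).homVanish_right ?_ ih)
    · exact hΔ.homVanish_of_ne hP hM (by lia) (by lia)
    · exact hΔP n hn _ (by lia)

theorem isSelfOrthogonal_thetaObj_tfae (hΔ : IsDeltaFamily P M s r Δ) (hP : IsSelfOrthogonal P)
    (hM : ∀ i : ℤ, (i < -s ∨ r - s < i) → HomVanish P M i) {T : ObjectProperty C}
    (hT : IsHomSymmetric T) (hTP : T P) (hTΔ : ∀ n, T (Δ n)) :
    List.TFAE [∀ i : ℤ, 0 < i → HomVanish M (Δ r) i, IsSelfOrthogonal (thetaObj P s r Δ r),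
      ∀ n : ℕ, r ≤ n → IsSelfOrthogonal (thetaObj P s r Δ n)] := by
  have hPΔ (n : ℕ) (hn : r ≤ n) (i : ℤ) (hi : i ≠ r - s - n) : HomVanish P (Δ n) i :=
    hΔ.homVanish_of_ne hP hM hn hi
  have hΔP (n : ℕ) (hn : r ≤ n) (i : ℤ) (hi : i ≠ n + s - r) : HomVanish (Δ n) P i :=
    neg_neg i ▸ hT hTP (hTΔ n) _ (hPΔ n hn (-i) (by lia))
  have hΘ (n : ℕ) (hn : r ≤ n) :=
    isSelfOrthogonal_thetaObj_iff (s := s) hP (hPΔ n hn) (hΔP n hn)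
  tfae_have 3 → 2 := fun h => h r le_rfl
  tfae_have 2 → 1 := fun h i hi =>
    (hΔ.homVanish_self_iff hP hM hi).1 ((hΘ r le_rfl).1 h i hi.ne')
  tfae_have 1 → 3 := by
    intro h n hn
    have hpos : ∀ i : ℤ, 0 < i → HomVanish (Δ n) (Δ n) i :=
      hΔ.homVanish_self_of_le hP hM hΔP
        (fun i hi => (hΔ.homVanish_self_iff hP hM hi).2 (h i hi)) hn
    refine (hΘ n hn).2 fun i hi => ?_
    rcases lt_or_gt_of_ne hi with hneg | hi
    · exact neg_neg i ▸ hT (hTΔ n) (hTΔ n) (-i) (hpos _ (by lia))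
    · exact hpos i hi
  tfae_finish

variable {T : ObjectProperty C} [T.IsTriangulated] [T.IsStableUnderRetracts]

lemma prop (hΔ : IsDeltaFamily P M s r Δ) (hP : T P) (hM : T M) (n : ℕ) : T (Δ n) := by
  induction n with
  | zero => exact T.prop_of_iso hΔ.1.some.symm hM
  | succ n ih => exact (hΔ.2 n).prop_target hP ih

lemma prop_of_prop (hΔ : IsDeltaFamily P M s r Δ) (hP : T P) (hn : T (Δ n)) : T M := by
  induction n with
  | zero => exact T.prop_of_iso hΔ.1.some hn
  | succ n ih => exact ih ((hΔ.2 n).prop_source hP hn)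

lemma prop_of_thetaObj (hΔ : IsDeltaFamily P M s r Δ) (hΘ : T (thetaObj P s r Δ n)) : T M := by
  let m : ℤ := n + s - r
  have hPm : T (P⟦m⟧) := T.prop_of_retract ⟨biprod.inr, biprod.snd, biprod.inr_snd⟩ hΘ
  have hP : T P := T.prop_of_iso ((shiftFunctorCompIsoId C m (-m) (add_neg_cancel m)).app P)
    (T.le_shift _ _ hPm)
  exact hΔ.prop_of_prop hP (T.prop_of_retract ⟨biprod.inl, biprod.fst, biprod.inl_fst⟩ hΘ)

end IsDeltaFamily

end DeltaFamily

section ProjectiveCover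

variable {E F F' M : Type*} [Ring E] [AddCommGroup F] [Module E F] [AddCommGroup F'] [Module E F']
  [AddCommGroup M] [Module E M] {f : F →ₗ[E] M}

lemma IsProjectiveCover.comp_linearEquiv (hf : IsProjectiveCover f) (e : F' ≃ₗ[E] F) :
    IsProjectiveCover (f ∘ₗ e.toLinearMap) where
  projective := have := hf.projective; .of_equiv e.symm
  surjective := hf.surjective.comp e.surjective
  superfluous N hN := by
    have hmap : N.map (e : F' →ₗ[E] F) = ⊤ := hf.superfluous _ <| by
      rw [← Submodule.map_comap_eq_of_surjective e.surjective (LinearMap.ker f),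
        ← LinearMap.ker_comp, ← Submodule.map_sup, hN, Submodule.map_top, LinearEquiv.range]
    exact (map_eq_top_iff (Submodule.orderIsoMapComap e)).1 hmap

lemma surjective_comp_subtype_of_minimal {N : Submodule E F}
    (hN : Minimal (fun N => N.map f = ⊤) N) {h : F →ₗ[E] N} (hh : ∀ x, f (h x) = f x) :
    Function.Surjective (h ∘ₗ N.subtype) := by
  have hmap : (N.map (N.subtype ∘ₗ h)).map f = ⊤ := by
    rw [← hN.prop, ← Submodule.map_comp]
    congr 1
    exact LinearMap.ext hh
  have hle : N.map (N.subtype ∘ₗ h) ≤ N := by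
    rintro _ ⟨x, -, rfl⟩
    exact (h x).2
  intro y
  obtain ⟨x, hx, hxy⟩ := hN.le_of_le hmap hle y.2
  exact ⟨⟨x, hx⟩, Subtype.ext hxy⟩

lemma exists_retraction_of_minimal [Module.Projective E F] [IsNoetherian E F] {N : Submodule E F}
    (hN : Minimal (fun N => N.map f = ⊤) N) : ∃ ρ : F →ₗ[E] N, ρ ∘ₗ N.subtype = .id := by
  have hfN : Function.Surjective (f ∘ₗ N.subtype) := by
    rw [← LinearMap.range_eq_top, LinearMap.range_comp, Submodule.range_subtype, hN.prop]
  obtain ⟨h, hh⟩ := Module.projective_lifting_property (f ∘ₗ N.subtype) f hfN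
  have hsurj := surjective_comp_subtype_of_minimal hN (LinearMap.congr_fun hh)
  let ψ := LinearEquiv.ofBijective (h ∘ₗ N.subtype)
    ⟨IsNoetherian.injective_of_surjective_endomorphism _ hsurj, hsurj⟩
  exact ⟨ψ.symm.toLinearMap ∘ₗ h, LinearMap.ext ψ.symm_apply_apply⟩

lemma isProjectiveCover_of_minimal {N : Submodule E F} [Module.Projective E N]
    (hN : Minimal (fun N => N.map f = ⊤) N) : IsProjectiveCover (f ∘ₗ N.subtype) where
  projective := ‹_›
  surjective := by
    rw [← LinearMap.range_eq_top, LinearMap.range_comp, Submodule.range_subtype, hN.prop]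
  superfluous L hL := by
    have hker : (LinearMap.ker (f ∘ₗ N.subtype)).map (f ∘ₗ N.subtype) = ⊥ :=
      (Submodule.eq_bot_iff _).2 fun _ ⟨_, hx, hxy⟩ => hxy ▸ hx
    have hmap : (L.map N.subtype).map f = ⊤ := by
      rw [← Submodule.map_comp, ← sup_bot_eq (L.map _), ← hker, ← Submodule.map_sup, hL,
        Submodule.map_comp, Submodule.map_subtype_top, hN.prop]
    have hLN : L.map N.subtype = N := hN.eq_of_le hmap (Submodule.map_subtype_le N L)
    exact Submodule.map_injective_of_injective N.injective_subtype
      (hLN.trans (Submodule.map_subtype_top N).symm)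

theorem exists_retraction_isProjectiveCover [Module.Projective E F] [IsArtinian E F]
    [IsNoetherian E F] (hf : Function.Surjective f) :
    ∃ (N : Submodule E F) (ρ : F →ₗ[E] N), ρ ∘ₗ N.subtype = .id ∧
      IsProjectiveCover (f ∘ₗ N.subtype) := by
  have htop : (⊤ : Submodule E F).map f = ⊤ := by
    rw [Submodule.map_top, LinearMap.range_eq_top.2 hf]
  obtain ⟨N, hN⟩ := exists_minimal_of_wellFoundedLT (fun N : Submodule E F => N.map f = ⊤) ⟨⊤, htop⟩
  obtain ⟨ρ, hρ⟩ := exists_retraction_of_minimal hN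
  have : Module.Projective E N := .of_split N.subtype ρ hρ
  exact ⟨N, ρ, hρ, isProjectiveCover_of_minimal hN⟩

end ProjectiveCover

section Coyoneda

variable {C : Type u} [Category.{v} C] [Preadditive C]

/-- `Hom(P, g)`, as a morphism of right `End P`-modules. -/
abbrev coyonedaMap (P : C) {X Y : C} (g : X ⟶ Y) : (P ⟶ X) →ₗ[(End P)ᵐᵒᵖ] (P ⟶ Y) :=
  ((preadditiveCoyonedaObj P).map g).hom

lemma moduleFinite_hom_of_moduleFinite (k : Type w) [Field k] [Linear k C] (P X : C)
    [Module.Finite k (P ⟶ X)] : Module.Finite (End P)ᵐᵒᵖ (P ⟶ X) :=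
  have : IsScalarTower k (End P)ᵐᵒᵖ (P ⟶ X) := ⟨fun c r x => Linear.smul_comp _ _ _ c r.unop x⟩
  .of_restrictScalars_finite k _ _

lemma isProjectiveCover_coyonedaMap_of_retract {P F X Q : C} {g : F ⟶ X}
    {N : Submodule (End P)ᵐᵒᵖ (P ⟶ F)}
    (hN : IsProjectiveCover (coyonedaMap P g ∘ₗ N.subtype))
    {ρ : (P ⟶ F) →ₗ[(End P)ᵐᵒᵖ] N} (hρ : ρ ∘ₗ N.subtype = .id) (e : Retract Q F)
    (he : ∀ x : P ⟶ F, (ρ x : P ⟶ F) = x ≫ e.r ≫ e.i) :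
    IsProjectiveCover (coyonedaMap P (e.i ≫ g)) := by
  have hρN (y : N) : ρ y = y := LinearMap.congr_fun hρ y
  let i := coyonedaMap P e.i
  let r := coyonedaMap P e.r
  have hri (x : P ⟶ Q) : r (i x) = x := by
    change (x ≫ e.i) ≫ e.r = x
    rw [Category.assoc, e.retract, Category.comp_id]
  have hir (x : P ⟶ F) : i (r x) = ρ x := (Category.assoc x e.r e.i).trans (he x).symm
  let ε : (P ⟶ Q) ≃ₗ[(End P)ᵐᵒᵖ] N := LinearEquiv.ofLinearMap (ρ ∘ₗ i) (r ∘ₗ N.subtype)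
    (LinearMap.ext fun y => by
      change ρ (i (r y)) = y
      rw [hir, hρN, hρN])
    (LinearMap.ext fun x => by
      change r (ρ (i x)) = x
      rw [← hir, hri, hri])
  convert hN.comp_linearEquiv ε using 1
  refine LinearMap.ext fun x => ?_
  change x ≫ e.i ≫ g = (ρ (i x) : P ⟶ F) ≫ g
  rw [← hir, hri]
  exact (Category.assoc _ _ _).symm

variable [HasFiniteBiproducts C]

/-- `Hom(P, Pⁿ)` is a free module of rank `n` over `End P`. -/
noncomputable def homBiproductEquiv (P : C) (n : ℕ) :
    (P ⟶ ⨁ fun _ : Fin n => P) ≃ₗ[(End P)ᵐᵒᵖ] (Fin n → (End P)ᵐᵒᵖ) where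
  toFun x j := MulOpposite.op (x ≫ biproduct.π _ j)
  invFun a := biproduct.lift fun j => (a j).unop
  map_add' x y := by
    ext j
    simp only [Preadditive.add_comp, MulOpposite.op_add, Pi.add_apply]
  map_smul' r x := funext fun j => congrArg MulOpposite.op (Category.assoc _ _ _)
  left_inv x := biproduct.hom_ext _ _ fun j => biproduct.lift_π _ j
  right_inv a := funext fun j => congrArg MulOpposite.op (biproduct.lift_π _ j)

lemma exists_comp_eq_of_linearMap {P Y : C} {n : ℕ}
    (φ : (P ⟶ ⨁ fun _ : Fin n => P) →ₗ[(End P)ᵐᵒᵖ] (P ⟶ Y)) :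
    ∃ e : (⨁ fun _ : Fin n => P) ⟶ Y, ∀ x, φ x = x ≫ e := by
  have hφ (r : End P) (x : P ⟶ ⨁ fun _ : Fin n => P) : φ (r ≫ x) = r ≫ φ x :=
    φ.map_smul (MulOpposite.op r) x
  refine ⟨biproduct.desc fun j => φ (biproduct.ι (fun _ : Fin n => P) j), fun x => ?_⟩
  have hx : x = ∑ j, (x ≫ biproduct.π _ j) ≫ biproduct.ι (fun _ : Fin n => P) j := by
    simp only [Category.assoc]
    rw [← Preadditive.comp_sum, biproduct.total, Category.comp_id]
  conv_lhs => rw [hx]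
  conv_rhs => rw [hx]
  rw [map_sum, Preadditive.sum_comp]
  refine Finset.sum_congr rfl fun j _ => ?_
  rw [hφ, Category.assoc _ _ (biproduct.desc _), biproduct.ι_desc]

lemma exists_surjective_coyonedaMap (P X : C) [Module.Finite (End P)ᵐᵒᵖ (P ⟶ X)] :
    ∃ (n : ℕ) (g : (⨁ fun _ : Fin n => P) ⟶ X),
      Function.Surjective (coyonedaMap P g) := by
  obtain ⟨n, x, hx⟩ := Module.Finite.exists_fin (R := (End P)ᵐᵒᵖ) (M := (P ⟶ X))
  refine ⟨n, biproduct.desc x, ?_⟩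
  rw [← LinearMap.range_eq_top, eq_top_iff, ← hx, Submodule.span_le]
  rintro _ ⟨j, rfl⟩
  exact ⟨biproduct.ι (fun _ : Fin n => P) j, biproduct.ι_desc x j⟩

theorem exists_isProjectiveCover_coyonedaMap (k : Type w) [Field k] [Linear k C]
    (P X : C) [Module.Finite k (End P)] [Module.Finite k (P ⟶ X)]
    (hP : ∀ (n : ℕ) (e : (⨁ fun _ : Fin n => P) ⟶ ⨁ fun _ : Fin n => P), e ≫ e = e →
      ∃ (Q : C) (ρ : Retract Q (⨁ fun _ : Fin n => P)), ρ.r ≫ ρ.i = e) :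
    ∃ (Q : C) (g : Q ⟶ X), InAdd P Q ∧
      IsProjectiveCover (coyonedaMap P g) := by
  have : Module.Finite k (End P)ᵐᵒᵖ := .equiv (MulOpposite.opLinearEquiv k)
  have : IsArtinianRing (End P)ᵐᵒᵖ := .of_finite k _
  have := moduleFinite_hom_of_moduleFinite k P X
  obtain ⟨n, g, hg⟩ := exists_surjective_coyonedaMap P X
  have : Module.Finite (End P)ᵐᵒᵖ (P ⟶ ⨁ fun _ : Fin n => P) :=
    .equiv (homBiproductEquiv P n).symm
  have : Module.Projective (End P)ᵐᵒᵖ (P ⟶ ⨁ fun _ : Fin n => P) :=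
    .of_equiv (homBiproductEquiv P n).symm
  obtain ⟨N, ρ, hρ, hN⟩ := exists_retraction_isProjectiveCover hg
  obtain ⟨e, he⟩ := exists_comp_eq_of_linearMap (N.subtype ∘ₗ ρ)
  have hee : e ≫ e = e := biproduct.hom_ext' _ _ fun j => by
    rw [← Category.assoc, ← he, ← he]
    exact congrArg N.subtype (LinearMap.congr_fun hρ _)
  obtain ⟨Q, q, hq⟩ := hP n e hee
  exact ⟨Q, q.i ≫ g, ⟨n, ⟨q⟩⟩, isProjectiveCover_coyonedaMap_of_retract hN hρ q
    fun x => hq ▸ he x⟩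

end Coyoneda

section IdempotentComplete

variable {C : Type u} [Category.{v} C] (T : ObjectProperty C)
  [IsIdempotentComplete T.FullSubcategory]

lemma exists_retract_of_isIdempotentComplete {X : C} (hX : T X) {e : X ⟶ X} (he : e ≫ e = e) :
    ∃ (Q : C) (ρ : Retract Q X), T Q ∧ ρ.r ≫ ρ.i = e := by
  obtain ⟨Y, i, p, hip, hpi⟩ := IsIdempotentComplete.idempotents_split
    (⟨X, hX⟩ : T.FullSubcategory) (ObjectProperty.homMk e) (by ext; exact he)
  exact ⟨Y.obj, ⟨i.hom, p.hom, congrArg (·.hom) hip⟩, Y.property, congrArg (·.hom) hpi⟩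

lemma isStableUnderRetracts_of_isIdempotentComplete [T.IsClosedUnderIsomorphisms] :
    T.IsStableUnderRetracts where
  of_retract {X Y} ρ hY := by
    obtain ⟨Q, σ, hQ, hσ⟩ := exists_retract_of_isIdempotentComplete T hY
      (e := ρ.r ≫ ρ.i) (by rw [Category.assoc, ρ.retract_assoc])
    refine T.prop_of_iso ⟨σ.i ≫ ρ.r, ρ.i ≫ σ.r, ?_, ?_⟩ hQ
    · rw [Category.assoc, ← Category.assoc ρ.r, ← hσ, Category.assoc, σ.retract,
        Category.comp_id, σ.retract]
    · rw [Category.assoc, ← Category.assoc σ.r, hσ, Category.assoc, ρ.retract,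
        Category.comp_id, ρ.retract]

end IdempotentComplete

section Existence

variable {C : Type u} [Category.{v} C] [Preadditive C] [HasZeroObject C] [HasFiniteBiproducts C]
  [HasShift C ℤ] [∀ n : ℤ, (shiftFunctor C n).Additive] [Pretriangulated C]
  {k : Type w} [Field k] [Linear k C] {T : ObjectProperty C} [T.IsTriangulated]
  [T.IsClosedUnderIsomorphisms] [IsIdempotentComplete T.FullSubcategory]

lemma exists_isDeltaStep (hfin : ∀ ⦃X Y : C⦄, T X → T Y → Module.Finite k (X ⟶ Y)) {P X : C}
    (hP : T P) (hX : T X) (m : ℤ) : ∃ Y, T Y ∧ IsDeltaStep P m X Y := by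
  have := isStableUnderRetracts_of_isIdempotentComplete T
  have : Module.Finite k (End P) := hfin hP hP
  have : Module.Finite k (P ⟶ X⟦-m⟧) := hfin hP (T.le_shift _ _ hX)
  obtain ⟨Q, g, hQ, hg⟩ := exists_isProjectiveCover_coyonedaMap k P (X⟦-m⟧) fun n e he => by
    obtain ⟨Q, ρ, -, hρ⟩ := exists_retract_of_isIdempotentComplete T
      (T.prop_of_isLimit_fan (biproduct.isLimit _) fun _ => hP) he
    exact ⟨Q, ρ, hρ⟩
  obtain ⟨Y, h, δ, hT⟩ := distinguished_cocone_triangle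
    (g⟦m⟧' ≫ (shiftFunctorCompIsoId C (-m) m (neg_add_cancel m)).hom.app X)
  have hstep : IsDeltaStep P m X Y := ⟨Q, g, h, δ, hQ, hg, hT⟩
  exact ⟨Y, hstep.prop_target hP hX, hstep⟩

theorem exists_isDeltaFamily (hfin : ∀ ⦃X Y : C⦄, T X → T Y → Module.Finite k (X ⟶ Y)) {P M : C}
    (hP : T P) (hM : T M) (s : ℤ) (r : ℕ) : ∃ Δ, IsDeltaFamily P M s r Δ := by
  choose Y hTY hY using fun (X : T.FullSubcategory) (n : ℕ) =>
    exists_isDeltaStep hfin hP X.property (n + s - r)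
  let Δ : ℕ → T.FullSubcategory := fun n => Nat.rec ⟨M, hM⟩ (fun n X => ⟨Y X n, hTY X n⟩) n
  exact ⟨fun n => (Δ n).obj, ⟨Iso.refl _⟩, fun n => hY (Δ n) n⟩

end Existence

section IdempotentLifting

open Polynomial

lemma aeval_mul_of_isIdempotentElem {k S : Type*} [CommRing k] [Ring S] [Algebra k S] {e : S}
    (he : IsIdempotentElem e) (p : k[X]) : aeval e p * e = p.eval 1 • e := by
  induction p using Polynomial.induction_on' with
  | add p q hp hq => rw [map_add, add_mul, hp, hq, eval_add, add_smul]
  | monomial n c =>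
    rw [aeval_monomial, mul_assoc, ← pow_succ, he.pow_succ_eq, eval_monomial, one_pow, mul_one,
      Algebra.smul_def]

/-- Write the minimal polynomial of `a` as `X ^ m * q` with `q` prime to `X`. The idempotent is
the projection of `k[a]` onto its factor where `a` is invertible. -/
theorem exists_isIdempotentElem_map_eq {k S T : Type*} [Field k] [Ring S] [Algebra k S] [Ring T]
    [Algebra k T] [Module.Finite k S] (f : S →ₐ[k] T) (a : S) (ha : IsIdempotentElem (f a)) :
    ∃ b, IsIdempotentElem b ∧ f b = f a := by
  have hmin : minpoly k a ≠ 0 := minpoly.ne_zero (.of_finite k a)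
  obtain ⟨q, hq, hXq⟩ := exists_eq_pow_rootMultiplicity_mul_and_not_dvd (minpoly k a) hmin 0
  set m := (minpoly k a).rootMultiplicity 0
  rw [C_0, sub_zero] at hq hXq
  obtain ⟨x, y, hxy⟩ : IsCoprime (X ^ (m + 1)) q :=
    (irreducible_X.coprime_iff_not_dvd.2 hXq).pow_left
  have hidem : x * X ^ (m + 1) * (x * X ^ (m + 1)) =
      x * X ^ (m + 1) - x * X * y * minpoly k a := by
    rw [hq]
    linear_combination x * X ^ (m + 1) * hxy
  have hq₁ : q.eval 1 • f a = 0 := by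
    have h := aeval_mul_of_isIdempotentElem ha (minpoly k a)
    rwa [aeval_algHom_apply, minpoly.aeval, map_zero, zero_mul, hq, eval_mul, eval_pow, eval_X,
      one_pow, one_mul, eq_comm] at h
  have hx₁ : x.eval 1 = 1 - y.eval 1 * q.eval 1 := by
    have h := congrArg (eval 1) hxy
    rw [eval_add, eval_mul, eval_mul, eval_pow, eval_X, one_pow, mul_one, eval_one] at h
    exact eq_sub_of_add_eq h
  refine ⟨aeval a (x * X ^ (m + 1)), ?_, ?_⟩
  · rw [IsIdempotentElem, ← map_mul, hidem, map_sub, map_mul _ _ (minpoly k a), minpoly.aeval,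
      mul_zero, sub_zero]
  · rw [← aeval_algHom_apply, map_mul, map_pow, aeval_X, ha.pow_succ_eq,
      aeval_mul_of_isIdempotentElem ha, hx₁, sub_smul, one_smul, mul_smul, hq₁, smul_zero, sub_zero]

variable {D E : Type*} [Category* D] [Category* E] [Preadditive D] [Preadditive E]
  (k : Type w) [Field k] [Linear k D] [Linear k E] (q : D ⥤ E) [q.Additive] [q.Linear k]

/-- The homomorphism of endomorphism algebras induced by a linear functor. -/
def endAlgHom (K : D) : End K →ₐ[k] End (q.obj K) where
  toFun := q.map
  map_one' := q.map_id K
  map_mul' _ _ := q.map_comp _ _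
  map_zero' := q.map_zero _ _
  map_add' _ _ := q.map_add
  commutes' c := by
    rw [Algebra.algebraMap_eq_smul_one, Algebra.algebraMap_eq_smul_one]
    exact (q.map_smul _ _).trans (congrArg _ (q.map_id K))

lemma exists_retract_map_eq_of_full [q.Full] [IsIdempotentComplete D] {K : D}
    [Module.Finite k (End K)] {e : q.obj K ⟶ q.obj K} (he : e ≫ e = e) :
    ∃ (K' : D) (ρ : Retract K' K), q.map (ρ.r ≫ ρ.i) = e := by
  obtain ⟨a, rfl⟩ := q.map_surjective e
  obtain ⟨b, hb, hba⟩ := exists_isIdempotentElem_map_eq (endAlgHom k q K) a he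
  obtain ⟨K', i, r, hir, hri⟩ := IsIdempotentComplete.idempotents_split K b hb
  exact ⟨K', ⟨i, r, hir⟩, (congrArg q.map hri).trans hba⟩

theorem isIdempotentComplete_map_fullSubcategory [q.Full] [IsIdempotentComplete D]
    (P : ObjectProperty D) [P.IsStableUnderRetracts]
    (hP : ∀ K, P K → Module.Finite k (End K)) :
    IsIdempotentComplete (P.map q).FullSubcategory where
  idempotents_split := by
    rintro ⟨X, K, hK, ⟨α⟩⟩ e he
    have := hP K hK
    replace he : e.hom ≫ e.hom = e.hom := congrArg (·.hom) he
    obtain ⟨K', ρ, hρ⟩ := exists_retract_map_eq_of_full k q (K := K)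
      (e := α.hom ≫ e.hom ≫ α.inv) (by simp [reassoc_of% he])
    rw [q.map_comp] at hρ
    refine ⟨⟨q.obj K', P.prop_map_obj q (P.prop_of_retract ρ hK)⟩,
      ObjectProperty.homMk (q.map ρ.i ≫ α.hom), ObjectProperty.homMk (α.inv ≫ q.map ρ.r), ?_, ?_⟩
    · ext
      simp [← q.map_comp, ρ.retract]
    · ext
      simp [reassoc_of% hρ]

end IdempotentLifting

section BoundedComplexes

variable {V : Type u} [Category.{v} V] [Preadditive V] (p : ObjectProperty V)

/-- The bounded cochain complexes with terms in `p`. -/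
def boundedComplexes : ObjectProperty (CochainComplex V ℤ) := fun K =>
  (∃ a b : ℤ, ∀ i : ℤ, (i < a ∨ b < i) → IsZero (K.X i)) ∧ ∀ i, p (K.X i)

/-- The homotopy category `K^b(p)` of bounded complexes with terms in `p`, as a (strictly) full
subcategory of the homotopy category of all cochain complexes. -/
abbrev boundedHomotopyCategory : ObjectProperty (HomotopyCategory V (ComplexShape.up ℤ)) :=
  (boundedComplexes p).map (HomotopyCategory.quotient _ _)

instance [p.IsStableUnderRetracts] : (boundedComplexes p).IsStableUnderRetracts where
  of_retract {K L} ρ := by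
    rintro ⟨⟨a, b, hL⟩, hpL⟩
    have ρ' (i : ℤ) : Retract (K.X i) (L.X i) := ρ.map (HomologicalComplex.eval _ _ i)
    refine ⟨⟨a, b, fun i hi => ?_⟩, fun i => p.prop_of_retract (ρ' i) (hpL i)⟩
    rw [IsZero.iff_id_eq_zero, ← (ρ' i).retract, (hL i hi).eq_of_tgt (ρ' i).i 0, zero_comp]

section Triangulated

open ZeroObject

variable [p.IsClosedUnderIsomorphisms]

instance [HasZeroObject V] [p.ContainsZero] : (boundedHomotopyCategory p).ContainsZero where
  exists_zero := by
    have hzero (i : ℤ) : IsZero ((0 : CochainComplex V ℤ).X i) :=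
      (HomologicalComplex.eval _ _ i).map_isZero (isZero_zero _)
    exact ⟨_, Functor.map_isZero _ (isZero_zero _), ObjectProperty.prop_map_obj _ _
      ⟨⟨0, 0, fun i _ => hzero i⟩, fun i => p.prop_of_isZero (hzero i)⟩⟩

lemma boundedHomotopyCategory_singleFunctor [HasZeroObject V] [p.ContainsZero] {M : V}
    (hM : p M) (j : ℤ) :
    boundedHomotopyCategory p ((HomotopyCategory.singleFunctor V j).obj M) := by
  have hzero (i : ℤ) (hi : i ≠ j) :
      IsZero (((HomologicalComplex.single V (ComplexShape.up ℤ) j).obj M).X i) :=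
    HomologicalComplex.isZero_single_obj_X _ _ _ _ hi
  refine ObjectProperty.prop_map_obj _ _ ⟨⟨j, j, fun i hi => hzero i (by lia)⟩, fun i => ?_⟩
  obtain rfl | hi := eq_or_ne i j
  · exact p.prop_of_iso (HomologicalComplex.singleObjXSelf _ _ M).symm hM
  · exact p.prop_of_isZero (hzero i hi)

variable [HasBinaryBiproducts V]

lemma boundedComplexes_mappingCone [p.IsClosedUnderBinaryProducts] {K L : CochainComplex V ℤ}
    (f : K ⟶ L) (hK : boundedComplexes p K) (hL : boundedComplexes p L) :
    boundedComplexes p (CochainComplex.mappingCone f) := by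
  obtain ⟨⟨a, b, hK⟩, hpK⟩ := hK
  obtain ⟨⟨a', b', hL⟩, hpL⟩ := hL
  refine ⟨⟨min a a' - 1, max b b', fun i hi => ?_⟩, fun i => ?_⟩
  · rw [CochainComplex.mappingCone.isZero_X_iff]
    exact ⟨hK _ (by grind), hL _ (by grind)⟩
  · exact p.prop_of_iso (HomologicalComplex.homotopyCofiber.XIsoBiprod f i (i + 1) rfl).symm
      (p.prop_of_isLimit_binaryFan (BinaryBiproduct.isLimit _ _) (hpK _) (hpL _))

variable [HasZeroObject V]

instance : (boundedHomotopyCategory p).IsStableUnderShift ℤ where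
  isStableUnderShiftBy n :=
    { le_shift := by
        rintro X ⟨K, ⟨⟨a, b, hK⟩, hpK⟩, ⟨e⟩⟩
        exact ⟨K⟦n⟧, ⟨⟨a - n, b - n, fun i hi => hK (i + n) (by lia)⟩, fun i => hpK (i + n)⟩,
          ⟨((HomotopyCategory.quotient _ _).commShiftIso n).app K ≪≫
            (shiftFunctor _ n).mapIso e⟩⟩ }

instance [p.IsClosedUnderBinaryProducts] :
    (boundedHomotopyCategory p).IsTriangulatedClosed₃ where
  ext₃' := by
    rintro T hT ⟨K, hK, ⟨e₁⟩⟩ ⟨L, hL, ⟨e₂⟩⟩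
    obtain ⟨f, hf⟩ := (HomotopyCategory.quotient _ _).map_surjective (e₁.hom ≫ T.mor₁ ≫ e₂.inv)
    refine ⟨_, (boundedHomotopyCategory p).prop_of_iso (Triangle.π₃.mapIso (isoTriangleOfIso₁₂ _ T
      (HomotopyCategory.mappingCone_triangleh_distinguished f) hT e₁ e₂ ?_))
      (ObjectProperty.prop_map_obj _ _ (boundedComplexes_mappingCone p f hK hL)), ⟨Iso.refl _⟩⟩
    change (HomotopyCategory.quotient _ _).map f ≫ e₂.hom = e₁.hom ≫ T.mor₁
    rw [hf, Category.assoc, Category.assoc, e₂.inv_hom_id, Category.comp_id]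

instance [p.ContainsZero] [p.IsClosedUnderBinaryProducts] :
    (boundedHomotopyCategory p).IsTriangulated where
  toIsTriangulatedClosed₂ := .of_isTriangulatedClosed₃

end Triangulated

section FiniteDimensional

variable {k : Type w} [Field k] [Linear k V] {p}

lemma moduleFinite_hom_of_boundedComplexes
    (hp : ∀ ⦃M N : V⦄, p M → p N → Module.Finite k (M ⟶ N)) {K L : CochainComplex V ℤ}
    (hK : boundedComplexes p K) (hL : boundedComplexes p L) : Module.Finite k (K ⟶ L) := by
  obtain ⟨⟨a, b, hK⟩, hpK⟩ := hK
  have (i : ℤ) : Module.Finite k (K.X i ⟶ L.X i) := hp (hpK i) (hL.2 i)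
  let F : (K ⟶ L) →ₗ[k] (∀ i : Finset.Icc a b, K.X i ⟶ L.X i) :=
    { toFun f i := f.f i
      map_add' _ _ := rfl
      map_smul' _ _ := rfl }
  refine Module.Finite.of_injective F fun f g hfg => ?_
  ext i
  by_cases hi : i ∈ Finset.Icc a b
  · exact congrFun hfg ⟨i, hi⟩
  · exact (hK i (by grind)).eq_of_src _ _

theorem moduleFinite_hom_of_boundedHomotopyCategory
    (hp : ∀ ⦃M N : V⦄, p M → p N → Module.Finite k (M ⟶ N))
    ⦃X Y : HomotopyCategory V (ComplexShape.up ℤ)⦄ (hX : boundedHomotopyCategory p X)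
    (hY : boundedHomotopyCategory p Y) : Module.Finite k (X ⟶ Y) := by
  obtain ⟨K, hK, ⟨e⟩⟩ := hX
  obtain ⟨L, hL, ⟨e'⟩⟩ := hY
  have : Module.Finite k (K ⟶ L) := moduleFinite_hom_of_boundedComplexes hp hK hL
  have : Module.Finite k
      ((HomotopyCategory.quotient _ _).obj K ⟶ (HomotopyCategory.quotient _ _).obj L) :=
    .of_surjective (Functor.mapLinearMap k (HomotopyCategory.quotient _ _))
      (HomotopyCategory.quotient _ _).map_surjective
  exact .equiv (Linear.homCongr k e e')

theorem isIdempotentComplete_boundedHomotopyCategory [IsIdempotentComplete (CochainComplex V ℤ)]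
    [p.IsStableUnderRetracts] (hp : ∀ ⦃M N : V⦄, p M → p N → Module.Finite k (M ⟶ N)) :
    IsIdempotentComplete (boundedHomotopyCategory p).FullSubcategory :=
  isIdempotentComplete_map_fullSubcategory k _ _ fun _ hK =>
    moduleFinite_hom_of_boundedComplexes hp hK hK

end FiniteDimensional

end BoundedComplexes

section BrutalTruncation

open HomologicalComplex

variable {V : Type u} [Category.{v} V] [Abelian V] (K : CochainComplex V ℤ) (b : ℤ)
  (hb : IsZero (K.X (b + 1)))

/-- The inclusion of the term in degree `b` into a complex that is zero in degree `b + 1`. -/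
noncomputable def topTermι : (single V (ComplexShape.up ℤ) b).obj (K.X b) ⟶ K :=
  mkHomFromSingle (𝟙 _) fun i hi => by
    obtain rfl : b + 1 = i := hi
    exact hb.eq_of_tgt _ _

lemma isIso_topTermι_f : IsIso ((topTermι K b hb).f b) := by
  rw [topTermι, mkHomFromSingle_f]
  infer_instance

lemma isZero_single_obj_X_of_ne {i : ℤ} (hi : i ≠ b) :
    IsZero (((single V (ComplexShape.up ℤ) b).obj (K.X b)).X i) :=
  isZero_single_obj_X _ _ _ _ hi

instance : Mono (topTermι K b hb) := mono_of_mono_f _ fun i => by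
  by_cases hi : i = b
  · subst hi
    have := isIso_topTermι_f K i hb
    infer_instance
  · exact (isZero_single_obj_X_of_ne K b hi).mono _

/-- The quotient of a complex that is zero in degree `b + 1` by its term in degree `b`. -/
noncomputable abbrev brutalTruncation : CochainComplex V ℤ := cokernel (topTermι K b hb)

/-- The short exact sequence `0 → Kᵇ[-b] → K → K/Kᵇ[-b] → 0`. -/
noncomputable abbrev topTermShortComplex : ShortComplex (CochainComplex V ℤ) :=
  .mk (topTermι K b hb) (cokernel.π _) (cokernel.condition _)

lemma topTermShortComplex_shortExact : (topTermShortComplex K b hb).ShortExact where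
  exact := ShortComplex.exact_of_g_is_cokernel _ (cokernelIsCokernel _)
  mono_f := inferInstanceAs (Mono (topTermι K b hb))
  epi_g := inferInstanceAs (Epi (cokernel.π _))

lemma isZero_brutalTruncation_X : IsZero ((brutalTruncation K b hb).X b) := by
  have := isIso_topTermι_f K b hb
  have := ((topTermShortComplex_shortExact K b hb).map_of_exact (eval V _ b)).epi_g
  refine IsZero.of_epi_eq_zero ((cokernel.π (topTermι K b hb)).f b) ?_
  rw [← cancel_epi ((topTermι K b hb).f b), comp_zero, ← comp_f, cokernel.condition, zero_f]

lemma isIso_cokernel_π_topTermι_f {i : ℤ} (hi : i ≠ b) :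
    IsIso ((cokernel.π (topTermι K b hb)).f i) := by
  have hi' := (topTermShortComplex_shortExact K b hb).map_of_exact (eval V _ i)
  have : Epi ((cokernel.π (topTermι K b hb)).f i) := hi'.epi_g
  have : Mono ((cokernel.π (topTermι K b hb)).f i) :=
    hi'.exact.mono_g ((isZero_single_obj_X_of_ne K b hi).eq_of_src _ _)
  exact isIso_of_mono_of_epi _

/-- In each degree one of the two maps is an isomorphism and the remaining term is zero. -/
noncomputable def topTermSplitting (i : ℤ) :
    ((topTermShortComplex K b hb).map (eval V _ i)).Splitting :=
  if hi : i = b then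
    .ofIsIsoOfIsZero _ (by subst hi; exact isIso_topTermι_f K i hb)
      (by subst hi; exact isZero_brutalTruncation_X K i hb)
  else
    .ofIsZeroOfIsIso _ (isZero_single_obj_X_of_ne K b hi) (isIso_cokernel_π_topTermι_f K b hb hi)

lemma trianglehOfDegreewiseSplit_topTerm_distinguished :
    CochainComplex.trianglehOfDegreewiseSplit _ (topTermSplitting K b hb) ∈
      distTriang (HomotopyCategory V (ComplexShape.up ℤ)) :=
  (HomotopyCategory.distinguished_iff_iso_trianglehOfDegreewiseSplit _).2
    ⟨_, topTermSplitting K b hb, ⟨Iso.refl _⟩⟩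

variable {p : ObjectProperty V} [p.IsClosedUnderIsomorphisms] [p.ContainsZero]
  {Q : ObjectProperty (HomotopyCategory V (ComplexShape.up ℤ))} [Q.IsTriangulated]
  [Q.IsClosedUnderIsomorphisms]

variable {K} in
lemma prop_brutalTruncation_X (hK : ∀ i, p (K.X i)) (i : ℤ) :
    p ((brutalTruncation K b hb).X i) := by
  by_cases hi : i = b
  · subst hi
    exact p.prop_of_isZero (isZero_brutalTruncation_X K i hb)
  · have := isIso_cokernel_π_topTermι_f K b hb hi
    exact p.prop_of_iso (asIso ((cokernel.π (topTermι K b hb)).f i)) (hK i)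

lemma prop_quotient_obj_of_prop_singleFunctor
    (hQ : ∀ M, p M → ∀ j, Q ((HomotopyCategory.singleFunctor V j).obj M)) (a : ℤ) (n : ℕ)
    (K : CochainComplex V ℤ) (hK : ∀ i, (i < a ∨ a + n ≤ i) → IsZero (K.X i))
    (hpK : ∀ i, p (K.X i)) : Q ((HomotopyCategory.quotient _ _).obj K) := by
  induction n generalizing K with
  | zero =>
    refine Q.prop_of_isZero (Functor.map_isZero _ ?_)
    rw [IsZero.iff_id_eq_zero]
    ext i
    exact (hK i (by lia)).eq_of_src _ _
  | succ n ih =>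
    have hb : IsZero (K.X (a + n + 1)) := hK _ (by lia)
    refine Q.ext_of_isTriangulatedClosed₂ _
      (trianglehOfDegreewiseSplit_topTerm_distinguished K (a + n) hb) (hQ _ (hpK _) _)
      (ih (brutalTruncation K (a + n) hb) (fun i hi => ?_) (prop_brutalTruncation_X _ hb hpK))
    by_cases hi' : i = a + n
    · subst hi'
      exact isZero_brutalTruncation_X K _ hb
    · have := isIso_cokernel_π_topTermι_f K (a + n) hb hi'
      exact (hK i (by lia)).of_iso (asIso ((cokernel.π (topTermι K (a + n) hb)).f i)).symm

theorem boundedHomotopyCategory_le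
    (hQ : ∀ M, p M → ∀ j, Q ((HomotopyCategory.singleFunctor V j).obj M)) :
    boundedHomotopyCategory p ≤ Q := by
  rintro X ⟨K, ⟨⟨a, b, hK⟩, hpK⟩, ⟨e⟩⟩
  exact Q.prop_of_iso e (prop_quotient_obj_of_prop_singleFunctor hQ a (b - a + 1).toNat K
    (fun i hi => hK i (by lia)) hpK)

end BrutalTruncation

section PerfectTrace

variable {k : Type w} [Field k] {C : Type u} [Category.{v} C] [Preadditive C] [Linear k C]

/-- A symmetric linear form `τ` on the endomorphisms of `P` such that the pairings
`(f, g) ↦ τ (f ≫ g)` identify `Hom(M, P)` with the dual of `Hom(P, M)` for every object `M`. -/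
structure IsSymmetrizingForm {P : C} (τ : (P ⟶ P) →ₗ[k] k) : Prop where
  symm (f g : P ⟶ P) : τ (f ≫ g) = τ (g ≫ f)
  eq_zero {M : C} (g : M ⟶ P) (hg : ∀ f : P ⟶ M, τ (f ≫ g) = 0) : g = 0
  exists_eq {M : C} (ψ : (P ⟶ M) →ₗ[k] k) : ∃ g : M ⟶ P, ∀ f, ψ f = τ (f ≫ g)

/-- A family of linear forms `t` on the endomorphisms of the objects satisfying `p`, with
`t (f ≫ g) = t (g ≫ f)`, such that the pairings `(f, g) ↦ t (f ≫ g)` identify `Hom(M, Q)` with the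
dual of `Hom(Q, M)` if `Q` satisfies `p`. The values of `t` at other objects are irrelevant. -/
structure IsPerfectTrace (p : ObjectProperty C) (t : ∀ Q : C, (Q ⟶ Q) →ₗ[k] k) : Prop where
  comm {Q Q' : C} (hQ : p Q) (hQ' : p Q') (f : Q ⟶ Q') (g : Q' ⟶ Q) : t Q (f ≫ g) = t Q' (g ≫ f)
  eq_zero {Q M : C} (hQ : p Q) (g : M ⟶ Q) (hg : ∀ f : Q ⟶ M, t Q (f ≫ g) = 0) : g = 0
  exists_eq {Q M : C} (hQ : p Q) (ψ : (Q ⟶ M) →ₗ[k] k) : ∃ g : M ⟶ Q, ∀ f, ψ f = t Q (f ≫ g)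

lemma IsPerfectTrace.mono {p q : ObjectProperty C} {t : ∀ Q : C, (Q ⟶ Q) →ₗ[k] k}
    (ht : IsPerfectTrace q t) (hpq : p ≤ q) : IsPerfectTrace p t where
  comm hQ hQ' := ht.comm (hpq _ hQ) (hpq _ hQ')
  eq_zero hQ := ht.eq_zero (hpq _ hQ)
  exists_eq hQ := ht.exists_eq (hpq _ hQ)

variable [HasFiniteBiproducts C] {P Q : C}

lemma InAdd.exists_sum_comp_eq_id (hQ : InAdd P Q) :
    ∃ (n : ℕ) (c : Fin n → (Q ⟶ P)) (e : Fin n → (P ⟶ Q)), ∑ l, c l ≫ e l = 𝟙 Q := by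
  obtain ⟨n, ⟨ρ⟩⟩ := hQ
  refine ⟨n, fun l => ρ.i ≫ biproduct.π (fun _ => P) l,
    fun l => biproduct.ι (fun _ => P) l ≫ ρ.r, ?_⟩
  calc ∑ l, (ρ.i ≫ biproduct.π (fun _ => P) l) ≫ biproduct.ι (fun _ => P) l ≫ ρ.r
    _ = ρ.i ≫ (∑ l, biproduct.π (fun _ => P) l ≫ biproduct.ι (fun _ => P) l) ≫ ρ.r := by
      simp only [Preadditive.sum_comp, Preadditive.comp_sum, Category.assoc]
    _ = 𝟙 Q := by rw [biproduct.total, Category.id_comp, ρ.retract]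

namespace IsSymmetrizingForm

variable {τ : (P ⟶ P) →ₗ[k] k}

/-- The trace of `f` is the sum of the values of `τ` at the diagonal entries of the matrix of `f`
in coordinates as in `InAdd.exists_sum_comp_eq_id`. -/
lemma exists_linearMap_comp_eq (hτ : IsSymmetrizingForm τ) (hQ : InAdd P Q) :
    ∃ T : (Q ⟶ Q) →ₗ[k] k, ∀ (h : Q ⟶ P) (x : P ⟶ Q), T (h ≫ x) = τ (x ≫ h) := by
  obtain ⟨n, c, e, hce⟩ := hQ.exists_sum_comp_eq_id
  refine ⟨∑ l, τ ∘ₗ Linear.leftComp k P (e l) ∘ₗ Linear.rightComp k Q (c l), fun h x => ?_⟩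
  calc (∑ l, τ ∘ₗ Linear.leftComp k P (e l) ∘ₗ Linear.rightComp k Q (c l)) (h ≫ x)
    _ = ∑ l, τ ((e l ≫ h) ≫ (x ≫ c l)) := by simp [LinearMap.sum_apply]
    _ = ∑ l, τ (x ≫ (c l ≫ e l) ≫ h) := Finset.sum_congr rfl fun l _ => by
      rw [hτ.symm, Category.assoc, Category.assoc]
    _ = τ (x ≫ h) := by
      rw [← map_sum, ← Preadditive.comp_sum, ← Preadditive.sum_comp, hce, Category.id_comp]

theorem exists_isPerfectTrace_inAdd (hτ : IsSymmetrizingForm τ) :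
    ∃ t : ∀ Q : C, (Q ⟶ Q) →ₗ[k] k, IsPerfectTrace (InAdd P) t := by
  have hT (Q : C) : ∃ T : (Q ⟶ Q) →ₗ[k] k,
      InAdd P Q → ∀ (h : Q ⟶ P) (x : P ⟶ Q), T (h ≫ x) = τ (x ≫ h) := by
    by_cases hQ : InAdd P Q
    · exact (hτ.exists_linearMap_comp_eq hQ).imp fun _ hT _ => hT
    · exact ⟨0, fun h => absurd h hQ⟩
  choose t ht using hT
  refine ⟨t, ⟨fun {Q Q'} hQ hQ' f g => ?_, fun {Q M} hQ g hg => ?_, fun {Q M} hQ ψ => ?_⟩⟩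
  · obtain ⟨n, c, e, hce⟩ := hQ'.exists_sum_comp_eq_id
    calc t Q (f ≫ g)
      _ = ∑ l, t Q ((f ≫ c l) ≫ e l ≫ g) := by
        conv_lhs => rw [← Category.id_comp g, ← hce]
        simp only [← map_sum, Preadditive.sum_comp, Preadditive.comp_sum, Category.assoc]
      _ = ∑ l, t Q' ((g ≫ f ≫ c l) ≫ e l) := Finset.sum_congr rfl fun l _ => by
        rw [ht _ hQ, ht _ hQ', Category.assoc]
      _ = t Q' (g ≫ f) := by
        simp only [← map_sum, Category.assoc, ← Preadditive.comp_sum, hce, Category.comp_id]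
  · obtain ⟨n, c, e, hce⟩ := hQ.exists_sum_comp_eq_id
    have hc (l : Fin n) : g ≫ c l = 0 := hτ.eq_zero _ fun h => by
      rw [← Category.assoc, ← ht _ hQ, ← Category.assoc, hg]
    rw [← Category.comp_id g, ← hce, Preadditive.comp_sum]
    exact Finset.sum_eq_zero fun l _ => by rw [← Category.assoc, hc, zero_comp]
  · obtain ⟨n, c, e, hce⟩ := hQ.exists_sum_comp_eq_id
    choose g hg using fun l => hτ.exists_eq (ψ ∘ₗ Linear.leftComp k M (c l))
    refine ⟨∑ l, g l ≫ e l, fun f => ?_⟩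
    calc ψ f
      _ = ∑ l, ψ (c l ≫ e l ≫ f) := by
        simp only [← map_sum, ← Category.assoc, ← Preadditive.sum_comp, hce, Category.id_comp]
      _ = ∑ l, t Q ((f ≫ g l) ≫ e l) := Finset.sum_congr rfl fun l _ => by
        rw [ht _ hQ, ← Category.assoc (e l), ← hg]; rfl
      _ = t Q (f ≫ ∑ l, g l ≫ e l) := by
        simp only [← map_sum, Category.assoc, Preadditive.comp_sum]

end IsSymmetrizingForm

end PerfectTrace

section TraceDuality

open CochainComplex.HomComplex

variable {k : Type w} [Field k] {C : Type u} [Category.{v} C] [Preadditive C] [Linear k C]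
  {p : ObjectProperty C} {t : ∀ Q : C, (Q ⟶ Q) →ₗ[k] k} {X Y : CochainComplex C ℤ} {S : Finset ℤ}

/-- The alternating sum of the traces of the components in degrees `i ∈ S` of a cochain of
degree `0`. -/
def supertrace (t : ∀ Q : C, (Q ⟶ Q) →ₗ[k] k) (X : CochainComplex C ℤ) (S : Finset ℤ) :
    Cochain X X 0 →ₗ[k] k where
  toFun φ := ∑ i ∈ S, i.negOnePow • t (X.X i) (φ.v i i (add_zero i))
  map_add' φ φ' := by simp only [Cochain.add_v, map_add, smul_add, Finset.sum_add_distrib]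
  map_smul' c φ := by
    simp only [Cochain.smul_v, map_smul, smul_comm _ c, ← Finset.smul_sum, RingHom.id_apply]

lemma supertrace_apply (φ : Cochain X X 0) :
    supertrace t X S φ = ∑ i ∈ S, i.negOnePow • t (X.X i) (φ.v i i (add_zero i)) := rfl

lemma supertrace_single_comp (hS : ∀ i, i ∉ S → IsZero (X.X i)) (i : ℤ) (f : X.X i ⟶ Y.X i)
    (φ : Cochain Y X 0) :
    supertrace t X S ((Cochain.single f 0).comp φ (add_zero 0)) =
      i.negOnePow • t (X.X i) (f ≫ φ.v i i (add_zero i)) := by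
  rw [supertrace_apply, Finset.sum_eq_single i]
  · rw [Cochain.zero_cochain_comp_v, Cochain.single_v]
  · intro j _ hj
    rw [Cochain.zero_cochain_comp_v, Cochain.single_v_eq_zero _ _ _ _ _ hj, zero_comp, map_zero,
      smul_zero]
  · intro hi
    rw [(hS i hi).eq_of_src (Cochain.v _ i i _) 0, map_zero, smul_zero]

lemma sum_sub_add_one_eq_zero {G : Type*} [AddCommGroup G] (y : ℤ → G)
    (hy : ∀ i, i ∉ S → y i = 0 ∧ y (i + 1) = 0) : ∑ i ∈ S, (y i - y (i + 1)) = 0 := by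
  have h₁ : ∑ᶠ i, y i = ∑ i ∈ S, y i :=
    finsum_eq_sum_of_support_subset _ fun i hi => by_contra fun h => hi (hy i h).1
  have h₂ : ∑ᶠ i, y (i + 1) = ∑ i ∈ S, y (i + 1) :=
    finsum_eq_sum_of_support_subset _ fun i hi => by_contra fun h => hi (hy i h).2
  rw [Finset.sum_sub_distrib, ← h₁, ← h₂, sub_eq_zero]
  exact (finsum_comp_equiv (Equiv.addRight 1)).symm

namespace IsPerfectTrace

lemma supertrace_δ_eq_zero (ht : IsPerfectTrace p t) (hX : ∀ i, p (X.X i))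
    (hS : ∀ i, i ∉ S → IsZero (X.X i)) (φ : Cochain X X (-1)) :
    supertrace t X S (δ (-1) 0 φ) = 0 := by
  let y (i : ℤ) : k := i.negOnePow • t (X.X i) (φ.v i (i - 1) rfl ≫ X.d (i - 1) i)
  have hcomm (i : ℤ) (i' : ℤ) (hi' : i + 1 + -1 = i') :
      t (X.X i') (X.d i' (i + 1) ≫ φ.v (i + 1) i' hi') = t (X.X (i + 1))
        (φ.v (i + 1) (i + 1 - 1) rfl ≫ X.d (i + 1 - 1) (i + 1)) := by
    subst hi'
    exact ht.comm (hX _) (hX _) _ _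
  have hy (i : ℤ) : i.negOnePow • t (X.X i) ((δ (-1) 0 φ).v i i (add_zero i)) =
      y i - y (i + 1) := by
    rw [δ_v (-1) 0 (by lia) φ i i (add_zero i) (i - 1) (i + 1) rfl rfl, Int.negOnePow_zero,
      one_smul, map_add, smul_add, hcomm, sub_eq_add_neg (y i)]
    simp only [y, Int.negOnePow_succ, Units.neg_smul, neg_neg]
  rw [supertrace_apply, Finset.sum_congr rfl fun i _ => hy i]
  refine sum_sub_add_one_eq_zero y fun i hi => ⟨?_, ?_⟩
  · simp only [y, (hS i hi).eq_of_src (φ.v i (i - 1) rfl) 0, zero_comp, map_zero, smul_zero]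
  · have hi' : i + 1 - 1 ∉ S := by rwa [add_sub_cancel_right]
    simp only [y, (hS _ hi').eq_of_src (X.d (i + 1 - 1) (i + 1)) 0, comp_zero, map_zero, smul_zero]

/-- If all morphisms `X ⟶ Y` are homotopic to zero, then every linear form on the cochains of
degree `0` which vanishes on the coboundaries vanishes on the cocycles, hence factors through
`δ 0 1`. -/
lemma exists_supertrace_comp_eq (ht : IsPerfectTrace p t) (hX : ∀ i, p (X.X i))
    (hS : ∀ i, i ∉ S → IsZero (X.X i)) (h : ∀ f : X ⟶ Y, Nonempty (Homotopy f 0)) (g : Y ⟶ X) :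
    ∃ ψ : Cochain X Y 1 →ₗ[k] k, ∀ φ : Cochain X Y 0,
      ψ (δ 0 1 φ) = supertrace t X S (φ.comp (Cochain.ofHom g) (add_zero 0)) := by
  let L : Cochain X Y 0 →ₗ[k] k := supertrace t X S ∘ₗ
    { toFun φ := φ.comp (Cochain.ofHom g) (add_zero 0)
      map_add' _ _ := Cochain.add_comp _ _ _ _
      map_smul' _ _ := Cochain.smul_comp _ _ _ _ }
  have hL : L ∈ (LinearMap.ker (δ_hom k X Y 0 1)).dualAnnihilator := by
    rw [Submodule.mem_dualAnnihilator]
    intro φ hφ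
    obtain ⟨f, rfl⟩ : ∃ f : X ⟶ Y, Cochain.ofHom f = φ :=
      ⟨(Cocycle.mk φ 1 rfl hφ).homOf, Cocycle.cochain_ofHom_homOf_eq_coe _⟩
    obtain ⟨z, hz⟩ := Cochain.equivHomotopy _ _ (h f).some
    rw [Cochain.ofHom_zero, add_zero] at hz
    change supertrace t X S ((Cochain.ofHom f).comp (Cochain.ofHom g) (add_zero 0)) = 0
    rw [hz, ← δ_comp_ofHom, ht.supertrace_δ_eq_zero hX hS]
  rw [← LinearMap.range_dualMap_eq_dualAnnihilator_ker] at hL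
  exact hL.imp fun ψ hψ => LinearMap.congr_fun hψ

lemma exists_cochain_single_eq (ht : IsPerfectTrace p t) (hX : ∀ i, p (X.X i))
    (ψ : Cochain X Y 1 →ₗ[k] k) : ∃ σ : Cochain Y X (-1), ∀ (i j : ℤ) (hij : i + -1 = j)
      (f : X.X j ⟶ Y.X i), ψ (Cochain.single f 1) = j.negOnePow • t (X.X j) (f ≫ σ.v i j hij) := by
  let singleMap (i j : ℤ) : (X.X j ⟶ Y.X i) →ₗ[k] Cochain X Y 1 :=
    { toFun f := Cochain.single f 1
      map_add' f g := by
        ext a b hab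
        simp only [Cochain.single, Cochain.mk_v, Cochain.add_v]
        split_ifs <;> simp
      map_smul' c f := by
        ext a b hab
        simp only [Cochain.single, Cochain.mk_v, Cochain.smul_v, RingHom.id_apply]
        split_ifs <;> simp }
  choose s hs using fun i j : ℤ => ht.exists_eq (hX j) (j.negOnePow • ψ ∘ₗ singleMap i j)
  refine ⟨Cochain.mk fun i j _ => s i j, fun i j hij f => ?_⟩
  rw [Cochain.mk_v, ← hs, LinearMap.smul_apply, smul_smul, Int.units_mul_self, one_smul]
  rfl

/-- A pairing which is perfect termwise: if `g` is orthogonal to all cocycles, it is the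
coboundary of the cochain `σ` representing the linear form `ψ` with `ψ (δ φ) = str (φ ≫ g)`. -/
theorem nonempty_homotopy_zero (ht : IsPerfectTrace p t) (hX : ∀ i, p (X.X i))
    (hS : ∀ i, i ∉ S → IsZero (X.X i)) (h : ∀ f : X ⟶ Y, Nonempty (Homotopy f 0)) (g : Y ⟶ X) :
    Nonempty (Homotopy g 0) := by
  obtain ⟨ψ, hψ⟩ := ht.exists_supertrace_comp_eq hX hS h g
  obtain ⟨σ, hσ⟩ := ht.exists_cochain_single_eq hX ψ
  have hψσ (i : ℤ) (f : X.X i ⟶ Y.X i) : ψ (δ 0 1 (Cochain.single f 0)) =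
      i.negOnePow • t (X.X i) (f ≫ (δ (-1) 0 σ).v i i (add_zero i)) := by
    have hcomm : t _ ((X.d (i - 1) i ≫ f) ≫ σ.v i (i - 1) rfl) =
        t _ (f ≫ σ.v i (i - 1) rfl ≫ X.d (i - 1) i) := by
      rw [Category.assoc, ht.comm (hX _) (hX _), Category.assoc]
    rw [Cochain.δ_single f 0 1 rfl (i - 1) (i + 1) (sub_add_cancel i 1) rfl, map_add,
      Int.negOnePow_one, Units.neg_smul, one_smul, map_neg,
      hσ (i + 1) i (add_neg_cancel_right i 1), hσ i (i - 1) rfl, hcomm,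
      δ_v (-1) 0 rfl σ i i (add_zero i) (i - 1) (i + 1) rfl rfl, Int.negOnePow_zero, one_smul,
      Preadditive.comp_add, map_add, smul_add, Int.negOnePow_sub, Int.negOnePow_one, mul_neg_one,
      Units.neg_smul, neg_neg, Category.assoc, add_comm]
  refine ⟨(Cochain.equivHomotopy _ _).symm ⟨σ, ?_⟩⟩
  rw [Cochain.ofHom_zero, add_zero]
  ext i
  rw [← sub_eq_zero]
  refine ht.eq_zero (hX i) _ fun f => ?_
  have hf := supertrace_single_comp (t := t) hS i f (Cochain.ofHom g)
  rw [← hψ, hψσ] at hf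
  rw [Preadditive.comp_sub, map_sub, sub_eq_zero]
  exact (smul_left_cancel _ hf).symm

theorem eq_zero_of_forall_eq_zero (ht : IsPerfectTrace p t)
    {X Y : HomotopyCategory C (ComplexShape.up ℤ)} (hX : boundedHomotopyCategory p X)
    (h : ∀ f : X ⟶ Y, f = 0) (g : Y ⟶ X) : g = 0 := by
  obtain ⟨K, ⟨⟨a, b, hK⟩, hpK⟩, ⟨e⟩⟩ := hX
  obtain ⟨L, rfl⟩ := HomotopyCategory.quotient_obj_surjective Y
  obtain ⟨g', hg'⟩ := (HomotopyCategory.quotient _ _).map_surjective (g ≫ e.inv)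
  rw [← cancel_mono e.inv, zero_comp, ← hg', HomotopyCategory.quotient_map_eq_zero_iff]
  refine ht.nonempty_homotopy_zero (S := Finset.Icc a b) hpK (fun i hi => hK i ?_) (fun f => ?_) g'
  · rw [Finset.mem_Icc] at hi
    lia
  · rw [← HomotopyCategory.quotient_map_eq_zero_iff, ← cancel_epi e.inv, h (e.inv ≫ _), comp_zero]

theorem isHomSymmetric (ht : IsPerfectTrace p t) : IsHomSymmetric (boundedHomotopyCategory p) :=
  fun X Y hX _ n h => by
    rw [← zero_sub, ← homVanish_shift_left_iff]
    intro g
    rw [← cancel_mono ((shiftFunctorZero _ ℤ).hom.app X),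
      ht.eq_zero_of_forall_eq_zero hX h (g ≫ _), zero_comp]

end IsPerfectTrace

end TraceDuality

section FinProj

/-- The finitely generated projective modules. -/
def finProj (R : Type u) [Ring R] : ObjectProperty (ModuleCat.{v} R) :=
  fun M => Module.Finite R M ∧ Module.Projective R M

variable (R : Type u) [Ring R]

instance : (finProj.{v} R).IsStableUnderRetracts where
  of_retract {M N} ρ := by
    rintro ⟨_, _⟩
    have h : ρ.r.hom ∘ₗ ρ.i.hom = LinearMap.id := by
      rw [← ModuleCat.hom_comp, ρ.retract, ModuleCat.hom_id]
    exact ⟨.of_surjective ρ.r.hom (LinearMap.surjective_of_comp_eq_id _ _ h), .of_split _ _ h⟩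

instance : (finProj.{v} R).IsClosedUnderBinaryProducts :=
  .mk' <| by
    rintro _ ⟨F, hF⟩
    obtain ⟨⟨_, _⟩, ⟨_, _⟩⟩ := And.intro (hF ⟨.left⟩) (hF ⟨.right⟩)
    exact (finProj R).prop_of_iso ((ModuleCat.biprodIsoProd _ _).symm ≪≫ biprod.isoProd _ _ ≪≫
      (HasLimit.isoOfNatIso (diagramIsoPair F)).symm) ⟨Module.Finite.prod, inferInstance⟩

instance : (finProj.{v} R).ContainsZero where
  exists_zero := ⟨.of R PUnit, ModuleCat.isZero_of_subsingleton _, inferInstance, inferInstance⟩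

open scoped ModuleCat in
variable {R} in
lemma moduleFinite_hom_of_finProj {k : Type w} [Field k] [Algebra k R] [Module.Finite k R]
    ⦃M N : ModuleCat.{v} R⦄ (hM : finProj R M) (hN : finProj R N) : Module.Finite k (M ⟶ N) := by
  have := hM.1
  have := hN.1
  have : Module.Finite k M := .trans R M
  have : Module.Finite k N := .trans R N
  have : Module.Finite k (M →ₗ[R] N) :=
    .of_injective (LinearMap.restrictScalarsₗ k R M N k) (LinearMap.restrictScalars_injective k)
  exact .equiv (ModuleCat.homLinearEquiv (S := k)).symm

end FinProj

lemma InAdd.map {C D : Type*} [Category* C] [Category* D] [Preadditive C] [Preadditive D]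
    [HasFiniteBiproducts C] [HasFiniteBiproducts D] {P X : C} (hX : InAdd P X) (F : C ⥤ D)
    [F.Additive] : InAdd (F.obj P) (F.obj X) := by
  obtain ⟨n, ⟨ρ⟩⟩ := hX
  exact ⟨n, ⟨(ρ.map F).trans (.ofIso (F.mapBiproduct _))⟩⟩

section RightRegular

variable (A : Type u) [Ring A]

/-- The algebra `A` as a right module over itself. This is not an abbreviation, so that
`k` acts on it through `Aᵐᵒᵖ`, as on all other objects of the category. -/
def rightRegular : ModuleCat.{u} Aᵐᵒᵖ := ModuleCat.of Aᵐᵒᵖ A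

/-- The right regular module is free of rank one. -/
def regularLinearEquiv : A ≃ₗ[Aᵐᵒᵖ] Aᵐᵒᵖ := MulOpposite.opLinearEquiv Aᵐᵒᵖ

variable {A} {M : ModuleCat.{u} Aᵐᵒᵖ}

lemma finProj_rightRegular : finProj Aᵐᵒᵖ (rightRegular A) :=
  ⟨.equiv (regularLinearEquiv A).symm, .of_equiv (regularLinearEquiv A).symm⟩

lemma inAdd_rightRegular_of_finProj (hM : finProj Aᵐᵒᵖ M) : InAdd (rightRegular A) M := by
  obtain ⟨_, _⟩ := hM
  obtain ⟨n, f, g, -, -, hfg⟩ := Module.Finite.exists_comp_eq_id_of_projective Aᵐᵒᵖ M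
  let e : ModuleCat.of Aᵐᵒᵖ (Fin n → Aᵐᵒᵖ) ≅ ⨁ fun _ : Fin n => rightRegular A :=
    (LinearEquiv.piCongrRight fun _ => (regularLinearEquiv A).symm).toModuleIso ≪≫
      (ModuleCat.biproductIsoPi fun _ : Fin n => rightRegular A).symm
  let ρ : Retract M (.of Aᵐᵒᵖ (Fin n → Aᵐᵒᵖ)) :=
    ⟨ModuleCat.ofHom g, ModuleCat.ofHom f, ModuleCat.hom_ext hfg⟩
  exact ⟨n, ⟨ρ.trans (.ofIso e)⟩⟩

lemma rightRegular_hom_apply (f : rightRegular A ⟶ M) (a : A) :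
    f.hom a = MulOpposite.op a • f.hom (1 : A) :=
  (congrArg f.hom (one_mul a).symm).trans (f.hom.map_smul (MulOpposite.op a) (1 : A))

/-- A morphism from the right regular module is determined by its value at `1`. -/
def homRightRegularEquiv : (rightRegular A ⟶ M) ≃+ M where
  toFun f := f.hom (1 : A)
  invFun x := ModuleCat.ofHom
    (LinearMap.toSpanSingleton Aᵐᵒᵖ M x ∘ₗ (regularLinearEquiv A).toLinearMap)
  left_inv f := by
    refine ModuleCat.hom_ext (LinearMap.ext fun (a : A) => ?_)
    exact (rightRegular_hom_apply f a).symm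
  right_inv x := one_smul _ x
  map_add' _ _ := rfl

end RightRegular

section SymmetrizingForm

open scoped ModuleCat

variable {k : Type w} {A : Type u} [Field k] [Ring A] [Algebra k A]

/-- A linear form `l` on `A` is a Frobenius form if `a ↦ l (a * -)` is an isomorphism of `A` onto
its dual. -/
def IsFrobeniusForm (l : A →ₗ[k] k) : Prop :=
  Function.Bijective fun a : A => l ∘ₗ LinearMap.mulLeft k a

lemma IsSymmetricAlg.exists_isFrobeniusForm (hA : IsSymmetricAlg k A) :
    ∃ l : A →ₗ[k] k, IsFrobeniusForm l ∧ ∀ a b, l (a * b) = l (b * a) := by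
  obtain ⟨φ, hφ⟩ := hA
  have hφ_left (a b : A) : φ 1 (a * b) = φ a b := by simpa using (hφ 1 1 a b).symm
  have hφ_right (a b : A) : φ 1 (b * a) = φ a b := by simpa using (hφ a 1 1 b).symm
  refine ⟨φ 1, ?_, fun a b => (hφ_left a b).trans (hφ_right a b).symm⟩
  rw [IsFrobeniusForm, show (fun a : A => φ 1 ∘ₗ LinearMap.mulLeft k a) = φ from
    funext fun a => LinearMap.ext (hφ_left a)]
  exact φ.bijective

namespace IsFrobeniusForm

variable {l : A →ₗ[k] k} {M : ModuleCat.{u} Aᵐᵒᵖ}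

lemma eq_of_forall_mul_right (hl : IsFrobeniusForm l) {a b : A} (h : ∀ y, l (a * y) = l (b * y)) :
    a = b :=
  hl.1 (LinearMap.ext h)

lemma eq_zero_of_forall_apply (hl : IsFrobeniusForm l) (g : M ⟶ rightRegular A)
    (hg : ∀ m, l (g.hom m) = 0) : g = 0 := by
  refine ModuleCat.hom_ext (LinearMap.ext fun m => hl.eq_of_forall_mul_right fun y => ?_)
  set b : A := g.hom m
  calc l (b * y) = l (g.hom (MulOpposite.op y • m)) := (congrArg l (g.hom.map_smul _ m)).symm
    _ = l (0 * y) := by rw [hg, zero_mul, map_zero]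

lemma exists_forall_apply_eq (hl : IsFrobeniusForm l) (θ : M →ₗ[k] k) :
    ∃ g : M ⟶ rightRegular A, ∀ m, l (g.hom m) = θ m := by
  choose g hg using fun m : M => hl.2
    { toFun y := θ (MulOpposite.op y • m)
      map_add' y z := by rw [MulOpposite.op_add, add_smul, map_add]
      map_smul' c y := by rw [MulOpposite.op_smul, smul_assoc, map_smul, RingHom.id_apply] }
  replace hg (m : M) (y : A) : l (g m * y) = θ (MulOpposite.op y • m) :=
    LinearMap.congr_fun (hg m) y
  refine ⟨ModuleCat.ofHom
    { toFun := g
      map_add' m n := hl.eq_of_forall_mul_right fun y => ?_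
      map_smul' a m := hl.eq_of_forall_mul_right fun y => ?_ }, fun m => ?_⟩
  · calc l (g (m + n) * y) = l (g m * y) + l (g n * y) := by
          rw [hg, smul_add, map_add, ← hg, ← hg]
      _ = l ((g m + g n) * y) := by rw [add_mul, map_add]
  · calc l (g (a • m) * y) = θ ((MulOpposite.op y * a) • m) := by rw [hg, mul_smul]
      _ = l (g m * (a.unop * y)) := (hg m (a.unop * y)).symm
      _ = l (g m * a.unop * y) := by rw [mul_assoc]
  · calc l (g m) = l (g m * 1) := by rw [mul_one]
      _ = θ m := by rw [hg, MulOpposite.op_one, one_smul]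

end IsFrobeniusForm

theorem IsSymmetricAlg.exists_isSymmetrizingForm (hA : IsSymmetricAlg k A) :
    ∃ τ : (rightRegular A ⟶ rightRegular A) →ₗ[k] k, IsSymmetrizingForm τ := by
  obtain ⟨l, hl, hl_symm⟩ := hA.exists_isFrobeniusForm
  let τ : (rightRegular A ⟶ rightRegular A) →ₗ[k] k :=
    { toFun f := l (f.hom (1 : A))
      map_add' f g := map_add l _ _
      map_smul' c f := by
        set a : A := f.hom (1 : A)
        change l (a * algebraMap k A c) = c * l a
        rw [← Algebra.commutes, ← Algebra.smul_def, map_smul, smul_eq_mul] }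
  have hτ {M : ModuleCat Aᵐᵒᵖ} (m : M) (g : M ⟶ rightRegular A) :
      τ (homRightRegularEquiv.symm m ≫ g) = l (g.hom m) :=
    congrArg (fun x => l (g.hom x)) (homRightRegularEquiv.apply_symm_apply m)
  refine ⟨τ, ⟨fun f g => ?_, fun {M} g hg => ?_, fun {M} ψ => ?_⟩⟩
  · set a : A := f.hom (1 : A)
    set b : A := g.hom (1 : A)
    calc l (g.hom a) = l (b * a) := congrArg l (rightRegular_hom_apply g a)
      _ = l (a * b) := hl_symm b a
      _ = l (f.hom b) := (congrArg l (rightRegular_hom_apply f b)).symm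
  · exact hl.eq_zero_of_forall_apply g fun m => (hτ m g).symm.trans (hg _)
  · let e : (rightRegular A ⟶ M) ≃ₗ[k] M := { homRightRegularEquiv with map_smul' _ _ := rfl }
    obtain ⟨g, hg⟩ := hl.exists_forall_apply_eq (ψ ∘ₗ e.symm.toLinearMap)
    refine ⟨g, fun f => ?_⟩
    obtain ⟨m, rfl⟩ := e.symm.surjective f
    exact (hg m).symm.trans (hτ m g).symm

end SymmetrizingForm

section KbProj

variable {A : Type u} [Ring A]

lemma kbProj_eq_boundedHomotopyCategory :
    KbProj A = boundedHomotopyCategory (finProj Aᵐᵒᵖ) := by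
  ext X
  constructor
  · rintro ⟨K, hK, hK', ⟨e⟩⟩
    exact ⟨K, ⟨hK, hK'⟩, ⟨e.symm⟩⟩
  · rintro ⟨K, ⟨hK, hK'⟩, ⟨e⟩⟩
    exact ⟨K, hK, hK', ⟨e.symm⟩⟩

instance : (KbProj A).IsTriangulated := by
  rw [kbProj_eq_boundedHomotopyCategory]
  infer_instance

instance : (KbProj A).IsClosedUnderIsomorphisms := by
  rw [kbProj_eq_boundedHomotopyCategory]
  infer_instance

lemma kbProj_regularComplex : KbProj A (regularComplex A) := by
  rw [kbProj_eq_boundedHomotopyCategory]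
  exact boundedHomotopyCategory_singleFunctor _ finProj_rightRegular 0

theorem kbProj_le_of_regularComplex {Q : ObjectProperty (KMod A)} [Q.IsTriangulated]
    [Q.IsStableUnderRetracts] (hQ : Q (regularComplex A)) : KbProj A ≤ Q := by
  rw [kbProj_eq_boundedHomotopyCategory]
  refine boundedHomotopyCategory_le fun M hM j => ?_
  have hM₀ : Q ((HomotopyCategory.singleFunctor _ 0).obj M) :=
    ((inAdd_rightRegular_of_finProj hM).map (HomotopyCategory.singleFunctor _ 0)).prop hQ
  exact Q.prop_of_iso
    (((HomotopyCategory.singleFunctors _).shiftIso (-j) j 0 (neg_add_cancel j)).app M)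
    (Q.le_shift _ _ hM₀)

section FiniteDimensional

open scoped ModuleCat

variable {k : Type w} [Field k] [Algebra k A]

theorem IsSymmetricAlg.isHomSymmetric_kbProj (hA : IsSymmetricAlg k A) :
    IsHomSymmetric (KbProj A) := by
  obtain ⟨τ, hτ⟩ := hA.exists_isSymmetrizingForm
  obtain ⟨t, ht⟩ := hτ.exists_isPerfectTrace_inAdd
  rw [kbProj_eq_boundedHomotopyCategory]
  exact (ht.mono fun _ => inAdd_rightRegular_of_finProj).isHomSymmetric

lemma moduleFinite_hom_of_kbProj [Module.Finite k A] ⦃X Y : KMod A⦄ (hX : KbProj A X)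
    (hY : KbProj A Y) : Module.Finite k (X ⟶ Y) := by
  have : Module.Finite k Aᵐᵒᵖ := .equiv (MulOpposite.opLinearEquiv k)
  rw [kbProj_eq_boundedHomotopyCategory] at hX hY
  exact moduleFinite_hom_of_boundedHomotopyCategory moduleFinite_hom_of_finProj hX hY

variable (k) in
lemma isIdempotentComplete_kbProj [Module.Finite k A] :
    IsIdempotentComplete (KbProj A).FullSubcategory := by
  have : Module.Finite k Aᵐᵒᵖ := .equiv (MulOpposite.opLinearEquiv k)
  rw [kbProj_eq_boundedHomotopyCategory]
  exact isIdempotentComplete_boundedHomotopyCategory (k := k) moduleFinite_hom_of_finProj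

end FiniteDimensional

end KbProj

section Cohomology

open CochainComplex HomComplex

lemma homVanish_quotient_iff {V : Type u} [Category.{v} V] [Preadditive V]
    (K L : CochainComplex V ℤ) (n : ℤ) :
    HomVanish ((HomotopyCategory.quotient _ _).obj K) ((HomotopyCategory.quotient _ _).obj L) n ↔
      ∀ x : Cocycle K L n, x ∈ coboundaries K L n := by
  let e := ((HomotopyCategory.quotient V (ComplexShape.up ℤ)).commShiftIso n).app L
  constructor
  · intro h x
    rw [← CohomologyClass.toHom_mk_eq_zero_iff, ← cancel_mono e.hom, h (_ ≫ e.hom), zero_comp]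
  · intro h f
    obtain ⟨c, hc⟩ := (CohomologyClass.toHom_bijective K L n).2 (f ≫ e.inv)
    obtain ⟨x, rfl⟩ := CohomologyClass.mk_surjective c
    rw [← cancel_mono e.inv, ← hc, zero_comp, CohomologyClass.toHom_mk_eq_zero_iff]
    exact h x

lemma homVanish_singleFunctor_quotient_iff {V : Type u} [Category.{v} V] [Preadditive V]
    [HasZeroObject V] (M : V) (K : CochainComplex V ℤ) (i : ℤ) :
    HomVanish ((HomotopyCategory.singleFunctor V 0).obj M)
        ((HomotopyCategory.quotient _ _).obj K) i ↔
      ∀ f : M ⟶ K.X i, f ≫ K.d i (i + 1) = 0 → ∃ g : M ⟶ K.X (i - 1), g ≫ K.d (i - 1) i = f := by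
  refine (homVanish_quotient_iff ((singleFunctor V 0).obj M) K i).trans
    ⟨fun h f hf => ?_, fun h x => ?_⟩
  · rw [← Cocycle.fromSingleMk_mem_coboundaries_iff f (zero_add i) (i + 1) rfl hf (i - 1)
      (sub_add_cancel i 1)]
    exact h _
  · obtain ⟨f, hf, rfl⟩ := Cocycle.fromSingleMk_surjective x i (zero_add i) (i + 1) rfl
    rw [Cocycle.fromSingleMk_mem_coboundaries_iff f (zero_add i) (i + 1) rfl hf (i - 1)
      (sub_add_cancel i 1)]
    exact h f hf

variable {A : Type u} [Ring A]

lemma isZero_cohomology_quotient_iff (K : CochainComplex (ModuleCat.{u} Aᵐᵒᵖ) ℤ) (i : ℤ) :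
    IsZero (cohomology ((HomotopyCategory.quotient _ _).obj K) i) ↔
      ∀ x : K.X i, K.d i (i + 1) x = 0 → ∃ y : K.X (i - 1), K.d (i - 1) i y = x := by
  calc IsZero (cohomology ((HomotopyCategory.quotient _ _).obj K) i)
    _ ↔ IsZero (K.homology i) :=
      ((HomotopyCategory.homologyFunctorFactors _ _ i).app K).isZero_iff
    _ ↔ (K.sc' (i - 1) i (i + 1)).Exact := by
      rw [← HomologicalComplex.exactAt_iff_isZero_homology,
        HomologicalComplex.exactAt_iff' K (i - 1) i (i + 1) (by simp) (by simp)]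
    _ ↔ _ := ShortComplex.moduleCat_exact_iff _

theorem homVanish_regularComplex_iff (X : KMod A) (i : ℤ) :
    HomVanish (regularComplex A) X i ↔ IsZero (cohomology X i) := by
  obtain ⟨K, rfl⟩ := HomotopyCategory.quotient_obj_surjective X
  have hcomp {M N : ModuleCat.{u} Aᵐᵒᵖ} (d : M ⟶ N) (f : rightRegular A ⟶ M) :
      homRightRegularEquiv (f ≫ d) = d (homRightRegularEquiv f) := rfl
  rw [isZero_cohomology_quotient_iff]
  refine (homVanish_singleFunctor_quotient_iff (rightRegular A) K i).trans ?_
  rw [(homRightRegularEquiv (M := K.X i)).surjective.forall]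
  refine forall_congr' fun f => ?_
  rw [(homRightRegularEquiv (M := K.X (i - 1))).surjective.exists]
  simp only [← hcomp, EmbeddingLike.apply_eq_iff_eq, EmbeddingLike.map_eq_zero_iff]

end Cohomology

section Tilting

variable {A : Type u} [Ring A] {P : KMod A} {s : ℤ} {r n : ℕ} {Δ : ℕ → KMod A}

lemma HasLengthWithTop.isZero_cohomology (h : HasLengthWithTop P s r) {i : ℤ}
    (hi : i < s - r ∨ s < i) : IsZero (cohomology P i) := by
  by_contra hzero
  have hs : i ≤ s := h.1.2 hzero
  have hsr : s - r ≤ i := h.2.2 hzero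
  lia

lemma IsDeltaFamily.isTilting_thetaObj_iff (hΔ : IsDeltaFamily P (regularComplex A) s r Δ)
    (hP : KbProj A P) (hΔn : KbProj A (Δ n)) :
    IsTilting (thetaObj P s r Δ n) ↔ IsSelfOrthogonal (thetaObj P s r Δ n) := by
  refine ⟨fun h => h.1.2, fun h => ⟨⟨prop_thetaObj hP hΔn, h⟩, ?_⟩⟩
  exact kbProj_le_of_regularComplex
    (hΔ.prop_of_thetaObj (n := n) (ObjectProperty.le_triangEnvelope _ _ (by simp)))

end Tilting

theorem mainTheorem8_general {k : Type w} {A : Type u} [Field k] [Ring A] [Algebra k A]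
    [Module.Finite k A] (hA : IsSymmetricAlg k A) (P : KMod A) (hP : IsPartialTilting P)
    (s : ℤ) (r : ℕ) (hcoh : ∀ i : ℤ, (i < s - r ∨ s < i) → IsZero (cohomology P i)) :
    (∃ Δ : ℕ → KMod A, IsDeltaFamily P (regularComplex A) s r Δ) ∧
    ∀ Δ : ℕ → KMod A, IsDeltaFamily P (regularComplex A) s r Δ →
      List.TFAE [∀ i : ℤ, 0 < i → IsZero (cohomology (Δ r) i), IsTilting (thetaObj P s r Δ r),
        ∀ n : ℕ, r ≤ n → IsTilting (thetaObj P s r Δ n)] := by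
  have := isIdempotentComplete_kbProj (A := A) k
  have := isStableUnderRetracts_of_isIdempotentComplete (KbProj A)
  have hM (i : ℤ) (hi : i < -s ∨ r - s < i) : HomVanish P (regularComplex A) i :=
    neg_neg i ▸ hA.isHomSymmetric_kbProj kbProj_regularComplex hP.1 (-i)
      ((homVanish_regularComplex_iff P (-i)).2 (hcoh (-i) (by lia)))
  refine ⟨exists_isDeltaFamily (moduleFinite_hom_of_kbProj (k := k)) hP.1 kbProj_regularComplex s r,
    fun Δ hΔ => ?_⟩
  have hΔT := hΔ.prop hP.1 kbProj_regularComplex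
  simpa only [homVanish_regularComplex_iff, hΔ.isTilting_thetaObj_iff hP.1 (hΔT _)] using
    hΔ.isSelfOrthogonal_thetaObj_tfae hP.2 hM hA.isHomSymmetric_kbProj hP.1 hΔT

theorem mainTheorem8 {k : Type w} {A : Type u} [Field k] [Ring A] [Algebra k A]
    [Module.Finite k A] (hA : IsSymmetricAlg k A)
    (P : KMod A) (hP : IsPartialTilting P) (s : ℤ) (r : ℕ) (hlen : HasLengthWithTop P s r) :
    (∃ Δ : ℕ → KMod A, IsDeltaFamily P (regularComplex A) s r Δ) ∧
    ∀ Δ : ℕ → KMod A, IsDeltaFamily P (regularComplex A) s r Δ →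
      ((∀ i : ℤ, 0 < i → IsZero (cohomology (Δ r) i)) ↔
        ∀ n : ℕ, r ≤ n → IsTilting (thetaObj P s r Δ n)) :=
  (mainTheorem8_general hA P hP s r fun _ => hlen.isZero_cohomology).imp_right
    fun h Δ hΔ => (h Δ hΔ).out 0 2
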